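/- Let $k$ be a commutative unital ring; algebras are associative $k$-algebras, not necessarily unital. For $k$-submodules $S,T$ of an algebra, $ST$ denotes the $k$-span of all products $st$ with $s\in S$, $t\in T$. A ring $R$ is $s$-unital if for every $r\in R$ there are $y,z\in R$ with $yr=r=rz$. A multiplier of an algebra $\mathcal I$ is a pair $w=(R,L)$ of $k$-linear maps $\mathcal I\to\mathcal I$, written $aw=R(a)$ and $wa=L(a)$, with $(ab)w=a(bw)$, $w(ab)=(wa)b$ and $(aw)b=a(wb)$ for all $a,b\in\mathcal I$; multipliers form a monoid $\mathcal M(\mathcal I)$ under $a(ww')=(aw)w'$, $(ww')a=w(w'a)$. A twisted partial action $\Theta$ of a group $G$ on an algebra $\mathcal A$ consists of two-sided ideals $\mathcal D_g$ of $\mathcal A$ and algebra isomorphisms $\theta_g:\mathcal D_{g^{-1}}\to\mathcal D_g$ ($g\in G$) and invertible elements $w_{g,h}\in\mathcal M(\mathcal D_g\mathcal D_{gh})$ ($g,h\in G$) such that for all $g,h,t\in G$: (1) $\mathcal D_g^2=\mathcal D_g$ and $\mathcal D_g\mathcal D_h=\mathcal D_h\mathcal D_g$; (2) $\mathcal D_1=\mathcal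 A$ and $\theta_1=\mathrm{id}_{\mathcal A}$; (3) $\theta_g(\mathcal D_{g^{-1}}\mathcal D_h)=\mathcal D_g\mathcal D_{gh}$; (4) $\theta_g(\theta_h(a))=w_{g,h}\,\theta_{gh}(a)\,w_{g,h}^{-1}$ for all $a\in\mathcal D_{h^{-1}}\mathcal D_{h^{-1}g^{-1}}$; (5) $w_{1,g}=w_{g,1}=1$; (6) $\theta_g(a\,w_{h,t})\,w_{g,ht}=\theta_g(a)\,w_{g,h}\,w_{gh,t}$ for all $a\in\mathcal D_{g^{-1}}\mathcal D_h\mathcal D_{ht}$. Its crossed product is the $G$-graded algebra $\bigoplus_{g\in G}\mathcal D_g\delta_g$ with multiplication $(a\delta_g)(b\delta_h)=\theta_g(\theta_g^{-1}(a)\,b)\,w_{g,h}\,\delta_{gh}$ for $a\in\mathcal D_g$, $b\in\mathcal D_h$. Theorem. Let $G$ be a group, let $\mathcal B=\bigoplus_{g\in G}\mathcal B_g$ be a $G$-graded algebra, put $\mathcal D_g=\mathcal B_g\mathcal B_{g^{-1}}$, and suppose that the ring $\mathcal D_g$ is $s$-unital for every $g\in G$. Then $\mathcal B$ is isomorphic,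 as a graded algebra, to the crossed product by some twisted partial action of $G$ on $\mathcal B_1$ if and only if the following two conditions hold: (i) $\mathcal B_g\mathcal B_{g^{-1}}\mathcal B_g=\mathcal B_g$ for all $g\in G$; (ii) for every $g\in G$ there exist an isomorphism $\psi_g:\mathcal D_g\to\mathcal B_g$ of left $\mathcal D_g$-modules and an isomorphism $\psi'_g:\mathcal D_{g^{-1}}\to\mathcal B_g$ of right $\mathcal D_{g^{-1}}$-modules such that $\psi_g(d)\,d'=d\,\psi'_g(d')$ for all $d\in\mathcal D_g$ and $d'\in\mathcal D_{g^{-1}}$. -/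

import Mathlib

/-! Algebras over a commutative unital ring `k` are associative and not necessarily unital. -/

section MulSpan

variable {k A : Type*} [CommRing k] [NonUnitalRing A] [Module k A]

/-- The product of two `k`-submodules of an algebra: the `k`-span of all the products
`a * b` with `a ∈ S` and `b ∈ T`. -/
def mulSpan (S T : Submodule k A) : Submodule k A :=
  Submodule.span k {x | ∃ a ∈ S, ∃ b ∈ T, a * b = x}

theorem mul_mem_mulSpan {S T : Submodule k A} {a b : A} (ha : a ∈ S) (hb : b ∈ T) :
    a * b ∈ mulSpan S T :=
  Submodule.subset_span ⟨a, ha, b, hb, rfl⟩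

theorem mulSpan_le {S T U : Submodule k A} :
    mulSpan S T ≤ U ↔ ∀ a ∈ S, ∀ b ∈ T, a * b ∈ U := by
  refine ⟨fun h a ha b hb => h (mul_mem_mulSpan ha hb), fun h => Submodule.span_le.2 ?_⟩
  rintro _ ⟨a, ha, b, hb, rfl⟩
  exact h a ha b hb

theorem mulSpan_mono {S S' T T' : Submodule k A} (hS : S ≤ S') (hT : T ≤ T') :
    mulSpan S T ≤ mulSpan S' T' :=
  mulSpan_le.2 fun _ ha _ hb => mul_mem_mulSpan (hS ha) (hT hb)

theorem mulSpan_assoc [IsScalarTower k A A] [SMulCommClass k A A] (S T U : Submodule k A) :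
    mulSpan (mulSpan S T) U = mulSpan S (mulSpan T U) := by
  apply le_antisymm
  · refine mulSpan_le.2 fun x hx c hc => ?_
    suffices h : mulSpan S T ≤
        (mulSpan S (mulSpan T U)).comap (LinearMap.mulRight k c) from h hx
    refine mulSpan_le.2 fun a ha b hb => ?_
    rw [Submodule.mem_comap, LinearMap.mulRight_apply, mul_assoc]
    exact mul_mem_mulSpan ha (mul_mem_mulSpan hb hc)
  · refine mulSpan_le.2 fun a ha x hx => ?_
    suffices h : mulSpan T U ≤
        (mulSpan (mulSpan S T) U).comap (LinearMap.mulLeft k a) from h hx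
    refine mulSpan_le.2 fun b hb c hc => ?_
    rw [Submodule.mem_comap, LinearMap.mulLeft_apply, ← mul_assoc]
    exact mul_mem_mulSpan (mul_mem_mulSpan ha hb) hc

end MulSpan

/-- A two-sided ideal of the `k`-algebra `A`. -/
structure AlgIdeal (k A : Type*) [CommRing k] [NonUnitalRing A] [Module k A]
    extends Submodule k A where
  mul_mem_left' : ∀ (a : A) {x : A}, x ∈ carrier → a * x ∈ carrier
  mul_mem_right' : ∀ {x : A} (a : A), x ∈ carrier → x * a ∈ carrier

namespace AlgIdeal

variable {k A : Type*} [CommRing k] [NonUnitalRing A] [Module k A]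

instance : SetLike (AlgIdeal k A) A where
  coe I := I.carrier
  coe_injective := by
    rintro ⟨I, _, _⟩ ⟨J, _, _⟩ h
    have : I = J := SetLike.coe_injective h
    subst this
    rfl

instance : NonUnitalSubringClass (AlgIdeal k A) A where
  add_mem {I} _ _ ha hb := I.toSubmodule.add_mem ha hb
  zero_mem I := I.toSubmodule.zero_mem
  neg_mem {I} _ ha := I.toSubmodule.neg_mem ha
  mul_mem {I} a _ _ hb := I.mul_mem_left' a hb

instance : SMulMemClass (AlgIdeal k A) k A where
  smul_mem {I} c _ ha := I.toSubmodule.smul_mem c ha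

theorem mul_mem_left (I : AlgIdeal k A) (a : A) {x : A} (hx : x ∈ I) : a * x ∈ I :=
  I.mul_mem_left' a hx

theorem mul_mem_right (I : AlgIdeal k A) {x : A} (a : A) (hx : x ∈ I) : x * a ∈ I :=
  I.mul_mem_right' a hx

theorem toSubmodule_inj {I J : AlgIdeal k A} (h : I.toSubmodule = J.toSubmodule) : I = J :=
  SetLike.coe_injective (congrArg (fun S : Submodule k A => (S : Set A)) h)

variable [IsScalarTower k A A] [SMulCommClass k A A]

/-- The product of two ideals. -/
instance : Mul (AlgIdeal k A) where
  mul I J :=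
    { mulSpan I.toSubmodule J.toSubmodule with
      mul_mem_left' := fun a x hx => by
        suffices h : mulSpan I.toSubmodule J.toSubmodule ≤
            (mulSpan I.toSubmodule J.toSubmodule).comap (LinearMap.mulLeft k a) from h hx
        refine mulSpan_le.2 fun b hb c hc => ?_
        rw [Submodule.mem_comap, LinearMap.mulLeft_apply, ← mul_assoc]
        exact mul_mem_mulSpan (I.mul_mem_left' a hb) hc
      mul_mem_right' := fun {x} a hx => by
        suffices h : mulSpan I.toSubmodule J.toSubmodule ≤
            (mulSpan I.toSubmodule J.toSubmodule).comap (LinearMap.mulRight k a) from h hx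
        refine mulSpan_le.2 fun b hb c hc => ?_
        rw [Submodule.mem_comap, LinearMap.mulRight_apply, mul_assoc]
        exact mul_mem_mulSpan hb (J.mul_mem_right' a hc) }

theorem toSubmodule_mul (I J : AlgIdeal k A) :
    (I * J).toSubmodule = mulSpan I.toSubmodule J.toSubmodule := rfl

instance : Semigroup (AlgIdeal k A) where
  mul_assoc _ _ _ := toSubmodule_inj (mulSpan_assoc _ _ _)

theorem mul_mem_mul {I J : AlgIdeal k A} {a b : A} (ha : a ∈ I) (hb : b ∈ J) : a * b ∈ I * J :=
  mul_mem_mulSpan (S := I.toSubmodule) (T := J.toSubmodule) ha hb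

theorem mem_left_of_mem_mul {I J : AlgIdeal k A} {x : A} (hx : x ∈ I * J) : x ∈ I :=
  (mulSpan_le (U := I.toSubmodule)).2 (fun _ ha b _ => I.mul_mem_right b ha) hx

theorem mem_right_of_mem_mul {I J : AlgIdeal k A} {x : A} (hx : x ∈ I * J) : x ∈ J :=
  (mulSpan_le (U := J.toSubmodule)).2 (fun a _ _ hb => J.mul_mem_left a hb) hx

end AlgIdeal

/-- A multiplier `w = (R, L)` of the algebra `A`, with `a w = R a` and `w a = L a`: `R` is an
endomorphism of the left module `A`, `L` is one of the right module `A`, and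
`(a w) b = a (w b)`. -/
@[ext]
structure Multiplier (k A : Type*) [CommRing k] [NonUnitalRing A] [Module k A] where
  R : A →ₗ[k] A
  L : A →ₗ[k] A
  R_mul : ∀ a b : A, R (a * b) = a * R b
  L_mul : ∀ a b : A, L (a * b) = L a * b
  balanced : ∀ a b : A, R a * b = a * L b

namespace Multiplier

variable {k A : Type*} [CommRing k] [NonUnitalRing A] [Module k A]

/-- Multiplication in the multiplier algebra: `a (w w') = (a w) w'` and `(w w') a = w (w' a)`. -/
instance : Monoid (Multiplier k A) where
  one := ⟨LinearMap.id, LinearMap.id, fun _ _ => rfl, fun _ _ => rfl, fun _ _ => rfl⟩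
  mul w w' :=
    { R := w'.R ∘ₗ w.R
      L := w.L ∘ₗ w'.L
      R_mul := fun a b => by simp [w.R_mul, w'.R_mul]
      L_mul := fun a b => by simp [w.L_mul, w'.L_mul]
      balanced := fun a b => by simp [w.balanced, w'.balanced] }
  mul_assoc _ _ _ := rfl
  one_mul _ := rfl
  mul_one _ := rfl

/-- A multiplier of an ideal `I` maps every idempotent ideal contained in `I` to itself. -/
theorem R_mem [IsScalarTower k A A] [SMulCommClass k A A] {I J : AlgIdeal k A}
    (w : Multiplier k I) (hJI : ∀ x ∈ J, x ∈ I) (hJ : J * J = J) {x : A} (hxI : x ∈ I)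
    (hx : x ∈ J) : (w.R ⟨x, hxI⟩ : A) ∈ J := by
  suffices h : ∀ y ∈ mulSpan J.toSubmodule J.toSubmodule,
      ∃ hy : y ∈ I, (w.R ⟨y, hy⟩ : A) ∈ J by
    rw [← hJ] at hx
    exact (h x hx).2
  intro y hy
  refine Submodule.span_induction ?_ ?_ ?_ ?_ hy
  · rintro _ ⟨a, ha, b, hb, rfl⟩
    refine ⟨I.mul_mem_left a (hJI b hb), ?_⟩
    have h : w.R ⟨a * b, I.mul_mem_left a (hJI b hb)⟩ = ⟨a, hJI a ha⟩ * w.R ⟨b, hJI b hb⟩ :=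
      w.R_mul ⟨a, hJI a ha⟩ ⟨b, hJI b hb⟩
    rw [h]
    exact J.mul_mem_right _ ha
  · refine ⟨zero_mem I, ?_⟩
    have h : w.R ⟨0, zero_mem I⟩ = 0 := map_zero w.R
    rw [h]
    exact zero_mem J
  · rintro a b _ _ ⟨ha, ha'⟩ ⟨hb, hb'⟩
    refine ⟨add_mem ha hb, ?_⟩
    have h : w.R ⟨a + b, add_mem ha hb⟩ = w.R ⟨a, ha⟩ + w.R ⟨b, hb⟩ :=
      map_add w.R ⟨a, ha⟩ ⟨b, hb⟩
    rw [h]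
    exact add_mem ha' hb'
  · rintro c a _ ⟨ha, ha'⟩
    refine ⟨SMulMemClass.smul_mem c ha, ?_⟩
    have h : w.R ⟨c • a, SMulMemClass.smul_mem c ha⟩ = c • w.R ⟨a, ha⟩ :=
      map_smul w.R c ⟨a, ha⟩
    rw [h]
    exact SMulMemClass.smul_mem c ha'

end Multiplier

/-- The part of a twisted partial action that does not involve the twisting: idempotent, pairwise
commuting ideals `D g` with `D 1 = A`, and algebra isomorphisms `θ g` from `D g⁻¹` onto `D g`,
with `θ 1` the identity and `θ g (D g⁻¹ * D h) = D g * D (g * h)`. -/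
structure PartialActionData (k G A : Type*) [CommRing k] [Group G] [NonUnitalRing A] [Module k A]
    [IsScalarTower k A A] [SMulCommClass k A A] where
  D : G → AlgIdeal k A
  θ : ∀ g : G, D g⁻¹ ≃ₗ[k] D g
  θ_mul : ∀ (g : G) (a b : D g⁻¹), θ g (a * b) = θ g a * θ g b
  D_idem : ∀ g : G, D g * D g = D g
  D_comm : ∀ g h : G, D g * D h = D h * D g
  D_one : ∀ a : A, a ∈ D 1
  θ_one : ∀ a : D (1 : G)⁻¹, (θ 1 a : A) = a
  θ_image : ∀ g h : G,
    (fun a : D g⁻¹ => (θ g a : A)) '' {a | (a : A) ∈ D g⁻¹ * D h} = (D g * D (g * h) : AlgIdeal k A)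

namespace PartialActionData

variable {k G A : Type*} [CommRing k] [Group G] [NonUnitalRing A] [Module k A]
  [IsScalarTower k A A] [SMulCommClass k A A] (P : PartialActionData k G A)

/-! The next facts say that the elements which occur in the axioms of a twisted partial action
lie in the domains of the maps that are applied to them. -/

theorem θ_mem {g h : G} {a : A} (ha : a ∈ P.D g⁻¹) (hah : a ∈ P.D g⁻¹ * P.D h) :
    (P.θ g ⟨a, ha⟩ : A) ∈ P.D g * P.D (g * h) := by
  have h1 : (P.θ g ⟨a, ha⟩ : A) ∈ ((P.D g * P.D (g * h) : AlgIdeal k A) : Set A) := by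
    rw [← P.θ_image g h]
    exact ⟨⟨a, ha⟩, hah, rfl⟩
  exact h1

theorem mem_inv_mul {g h : G} {a : A} (ha : a ∈ P.D h⁻¹ * P.D (h⁻¹ * g⁻¹)) :
    a ∈ P.D (g * h)⁻¹ := by
  rw [mul_inv_rev]
  exact AlgIdeal.mem_right_of_mem_mul ha

theorem θ_mem_inv {g h : G} {a : A} (ha : a ∈ P.D h⁻¹ * P.D (h⁻¹ * g⁻¹)) :
    (P.θ h ⟨a, AlgIdeal.mem_left_of_mem_mul ha⟩ : A) ∈ P.D g⁻¹ := by
  have h1 := AlgIdeal.mem_right_of_mem_mul (P.θ_mem (AlgIdeal.mem_left_of_mem_mul ha) ha)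
  rwa [mul_inv_cancel_left] at h1

theorem θ_mul_mem {g h : G} {a : A} (ha : a ∈ P.D h⁻¹ * P.D (h⁻¹ * g⁻¹)) :
    (P.θ (g * h) ⟨a, P.mem_inv_mul ha⟩ : A) ∈ P.D g * P.D (g * h) := by
  have h1 : a ∈ P.D (g * h)⁻¹ * P.D h⁻¹ := by
    rw [P.D_comm, mul_inv_rev]
    exact ha
  have h2 := P.θ_mem (P.mem_inv_mul ha) h1
  rwa [mul_inv_cancel_right, P.D_comm] at h2

theorem mem_mul_one {g h t : G} {a : A} (ha : a ∈ P.D g⁻¹ * P.D h * P.D t) :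
    a ∈ P.D g⁻¹ * P.D h := AlgIdeal.mem_left_of_mem_mul ha

theorem mem_mul_two {g h t : G} {a : A} (ha : a ∈ P.D g⁻¹ * P.D h * P.D t) :
    a ∈ P.D h * P.D t := by
  rw [mul_assoc] at ha
  exact AlgIdeal.mem_right_of_mem_mul ha

theorem mem_mul_three {g h t : G} {a : A} (ha : a ∈ P.D g⁻¹ * P.D h * P.D t) :
    a ∈ P.D g⁻¹ * P.D t := by
  rw [mul_assoc, P.D_comm h t, ← mul_assoc] at ha
  exact AlgIdeal.mem_left_of_mem_mul ha

theorem mem_inv {g h t : G} {a : A} (ha : a ∈ P.D g⁻¹ * P.D h * P.D t) :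
    a ∈ P.D g⁻¹ := AlgIdeal.mem_left_of_mem_mul (P.mem_mul_one ha)

theorem idem₃ (r s t : G) : P.D r * P.D s * P.D t * (P.D r * P.D s * P.D t) =
    P.D r * P.D s * P.D t := by
  have hc : ∀ g h : G, Commute (P.D g) (P.D h) := P.D_comm
  have h1 : IsIdempotentElem (P.D r * P.D s) :=
    IsIdempotentElem.mul_of_commute (hc r s) (P.D_idem r) (P.D_idem s)
  exact IsIdempotentElem.mul_of_commute ((hc r t).mul_left (hc s t)) h1 (P.D_idem t)

theorem R_mem_mul {g h t : G} (w : Multiplier k ↥(P.D h * P.D t)) {a : A}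
    (ha : a ∈ P.D g⁻¹ * P.D h * P.D t) :
    (w.R ⟨a, P.mem_mul_two ha⟩ : A) ∈ P.D g⁻¹ * P.D h * P.D t :=
  w.R_mem (fun _ hx => P.mem_mul_two hx) (P.idem₃ _ _ _) _ ha

theorem θ_R_mem {g h t : G} (w : Multiplier k ↥(P.D h * P.D t)) {a : A}
    (ha : a ∈ P.D g⁻¹ * P.D h * P.D t) :
    (P.θ g ⟨w.R ⟨a, P.mem_mul_two ha⟩, P.mem_inv (P.R_mem_mul w ha)⟩ : A) ∈
      P.D g * P.D (g * t) :=
  P.θ_mem _ (P.mem_mul_three (P.R_mem_mul w ha))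

theorem θ_mem_mul {g h t : G} {a : A} (ha : a ∈ P.D g⁻¹ * P.D h * P.D t) :
    (P.θ g ⟨a, P.mem_inv ha⟩ : A) ∈ P.D g * P.D (g * h) :=
  P.θ_mem _ (P.mem_mul_one ha)

theorem θ_mem₃ {g h t : G} {a : A} (ha : a ∈ P.D g⁻¹ * P.D h * P.D t) :
    (P.θ g ⟨a, P.mem_inv ha⟩ : A) ∈ P.D g * P.D (g * h) * P.D (g * t) := by
  -- `a` is a sum of products of two elements of `D g⁻¹ * D h * D t`
  set J := P.D g⁻¹ * P.D h * P.D t with hJ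
  have hJJ : J * J = J := P.idem₃ _ _ _
  suffices h : ∀ y ∈ mulSpan J.toSubmodule J.toSubmodule,
      ∃ hy : y ∈ P.D g⁻¹, (P.θ g ⟨y, hy⟩ : A) ∈ P.D g * P.D (g * h) * P.D (g * t) by
    have ha' := ha
    rw [← hJJ] at ha'
    exact (h a ha').2
  intro y hy
  refine Submodule.span_induction ?_ ?_ ?_ ?_ hy
  · rintro _ ⟨b, hb, c, hc, rfl⟩
    refine ⟨AlgIdeal.mul_mem_left _ b (P.mem_inv hc), ?_⟩
    have h1 : P.θ g ⟨b * c, AlgIdeal.mul_mem_left _ b (P.mem_inv hc)⟩ =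
        P.θ g ⟨b, P.mem_inv hb⟩ * P.θ g ⟨c, P.mem_inv hc⟩ :=
      P.θ_mul g ⟨b, P.mem_inv hb⟩ ⟨c, P.mem_inv hc⟩
    rw [h1]
    exact AlgIdeal.mul_mem_mul (P.θ_mem_mul hb)
      (AlgIdeal.mem_right_of_mem_mul (P.θ_mem (P.mem_inv hc) (P.mem_mul_three hc)))
  · refine ⟨zero_mem _, ?_⟩
    have h1 : P.θ g ⟨0, zero_mem _⟩ = 0 := map_zero (P.θ g)
    rw [h1]
    exact zero_mem _
  · rintro b c _ _ ⟨hb, hb'⟩ ⟨hc, hc'⟩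
    refine ⟨add_mem hb hc, ?_⟩
    have h1 : P.θ g ⟨b + c, add_mem hb hc⟩ = P.θ g ⟨b, hb⟩ + P.θ g ⟨c, hc⟩ :=
      map_add (P.θ g) ⟨b, hb⟩ ⟨c, hc⟩
    rw [h1]
    exact add_mem hb' hc'
  · rintro r b _ ⟨hb, hb'⟩
    refine ⟨SMulMemClass.smul_mem r hb, ?_⟩
    have h1 : P.θ g ⟨r • b, SMulMemClass.smul_mem r hb⟩ = r • P.θ g ⟨b, hb⟩ :=
      map_smul (P.θ g) r ⟨b, hb⟩
    rw [h1]
    exact SMulMemClass.smul_mem r hb'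

theorem R_θ_mem {g h t : G} (w : Multiplier k ↥(P.D g * P.D (g * h))) {a : A}
    (ha : a ∈ P.D g⁻¹ * P.D h * P.D (h * t)) :
    (w.R ⟨P.θ g ⟨a, P.mem_inv ha⟩, P.θ_mem_mul ha⟩ : A) ∈ P.D (g * h) * P.D (g * h * t) := by
  have h1 := w.R_mem (J := P.D g * P.D (g * h) * P.D (g * (h * t)))
    (fun _ hx => AlgIdeal.mem_left_of_mem_mul hx) (P.idem₃ _ _ _) (P.θ_mem_mul ha) (P.θ_mem₃ ha)
  rw [mul_assoc, ← mul_assoc g h t] at h1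
  exact AlgIdeal.mem_right_of_mem_mul h1

end PartialActionData

/-- A twisted partial action of the group `G` on the algebra `A`: partial action data together with
invertible multipliers `w g h` of `D g * D (g * h)` such that
`θ g (θ h a) = w g h (θ (g * h) a) (w g h)⁻¹` for `a ∈ D h⁻¹ * D (h⁻¹ * g⁻¹)`,
`w 1 g = w g 1 = 1`, and `θ g (a (w h t)) (w g (h * t)) = θ g a (w g h) (w (g * h) t)` for
`a ∈ D g⁻¹ * D h * D (h * t)`. -/
structure TwistedPartialAction (k G A : Type*) [CommRing k] [Group G] [NonUnitalRing A]
    [Module k A] [IsScalarTower k A A] [SMulCommClass k A A] extends PartialActionData k G A where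
  w : ∀ g h : G, (Multiplier k ↥(D g * D (g * h)))ˣ
  θ_θ : ∀ (g h : G) (a : A) (ha : a ∈ D h⁻¹ * D (h⁻¹ * g⁻¹)),
    (θ g ⟨θ h ⟨a, AlgIdeal.mem_left_of_mem_mul ha⟩, toPartialActionData.θ_mem_inv ha⟩ : A) =
      (w g h)⁻¹.val.R ((w g h).val.L
        ⟨θ (g * h) ⟨a, toPartialActionData.mem_inv_mul ha⟩, toPartialActionData.θ_mul_mem ha⟩)
  w_one_left : ∀ g : G, w 1 g = 1
  w_one_right : ∀ g : G, w g 1 = 1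
  cocycle : ∀ (g h t : G) (a : A) (ha : a ∈ D g⁻¹ * D h * D (h * t)),
    ((w g (h * t)).val.R
      ⟨θ g ⟨(w h t).val.R ⟨a, toPartialActionData.mem_mul_two ha⟩,
          toPartialActionData.mem_inv (toPartialActionData.R_mem_mul _ ha)⟩,
        toPartialActionData.θ_R_mem _ ha⟩ : A) =
      (w (g * h) t).val.R
        ⟨(w g h).val.R ⟨θ g ⟨a, toPartialActionData.mem_inv ha⟩,
            toPartialActionData.θ_mem_mul ha⟩,
          toPartialActionData.R_θ_mem _ ha⟩

namespace TwistedPartialAction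

variable {k G A : Type*} [CommRing k] [Group G] [NonUnitalRing A] [Module k A]
  [IsScalarTower k A A] [SMulCommClass k A A]

/-- The map `(a, b) ↦ θ g ((θ g)⁻¹ a * b)` from `D g × D h` to `D g * D (g * h)`. -/
def preMul (Θ : TwistedPartialAction k G A) (g h : G) (a : Θ.D g) (b : Θ.D h) :
    ↥(Θ.D g * Θ.D (g * h)) :=
  ⟨Θ.θ g ⟨((Θ.θ g).symm a : A) * b, AlgIdeal.mul_mem_right _ _ ((Θ.θ g).symm a).2⟩,
    Θ.θ_mem _ (AlgIdeal.mul_mem_mul ((Θ.θ g).symm a).2 b.2)⟩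

/-- The inclusion of `D g * D (g * h)` in `D (g * h)`. -/
def incl (Θ : TwistedPartialAction k G A) (g h : G) :
    ↥(Θ.D g * Θ.D (g * h)) →ₗ[k] Θ.D (g * h) where
  toFun x := ⟨x, AlgIdeal.mem_right_of_mem_mul x.2⟩
  map_add' _ _ := rfl
  map_smul' _ _ := rfl

/-- The product `(a δ_g) (b δ_h) = θ g ((θ g)⁻¹ a * b) w g h δ_{gh}` of homogeneous elements. -/
def homogMul (Θ : TwistedPartialAction k G A) (g h : G) :
    Θ.D g →ₗ[k] Θ.D h →ₗ[k] Θ.D (g * h) :=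
  LinearMap.mk₂ k (fun a b => Θ.incl g h ((Θ.w g h).val.R (Θ.preMul g h a b)))
    (fun a a' b => by
      rw [← map_add, ← map_add]
      congr 2
      apply Subtype.ext
      change (Θ.θ g _ : A) = Θ.θ g _ + Θ.θ g _
      rw [← AddMemClass.coe_add, ← map_add]
      congr 2
      apply Subtype.ext
      simp [add_mul])
    (fun c a b => by
      rw [← map_smul, ← map_smul]
      congr 2
      apply Subtype.ext
      change (Θ.θ g _ : A) = c • (Θ.θ g _ : A)
      rw [← SetLike.val_smul, ← map_smul]
      congr 2
      apply Subtype.ext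
      simp [smul_mul_assoc])
    (fun a b b' => by
      rw [← map_add, ← map_add]
      congr 2
      apply Subtype.ext
      change (Θ.θ g _ : A) = Θ.θ g _ + Θ.θ g _
      rw [← AddMemClass.coe_add, ← map_add]
      congr 2
      apply Subtype.ext
      simp [mul_add])
    (fun c a b => by
      rw [← map_smul, ← map_smul]
      congr 2
      apply Subtype.ext
      change (Θ.θ g _ : A) = c • (Θ.θ g _ : A)
      rw [← SetLike.val_smul, ← map_smul]
      congr 2
      apply Subtype.ext
      simp [mul_smul_comm])

/-- The crossed product of `A` and `G` by `Θ`: the direct sum of the `D g`, the element `a δ_g`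
being `DirectSum.lof k G _ g a`. -/
def CrossedProduct (Θ : TwistedPartialAction k G A) : Type _ :=
  DirectSum G fun g => Θ.D g

namespace CrossedProduct

variable (Θ : TwistedPartialAction k G A)

noncomputable instance : AddCommGroup Θ.CrossedProduct :=
  inferInstanceAs (AddCommGroup (DirectSum G fun g => Θ.D g))

noncomputable instance : Module k Θ.CrossedProduct :=
  inferInstanceAs (Module k (DirectSum G fun g => Θ.D g))

variable [DecidableEq G]

/-- The map `a ↦ a δ_g`. -/
noncomputable def single (g : G) : Θ.D g →ₗ[k] Θ.CrossedProduct :=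
  DirectSum.lof k G (fun g => Θ.D g) g

/-- The linear map on the crossed product with given restrictions to the `D g δ_g`. -/
noncomputable def lift {M : Type*} [AddCommGroup M] [Module k M]
    (f : ∀ g : G, Θ.D g →ₗ[k] M) : Θ.CrossedProduct →ₗ[k] M :=
  DirectSum.toModule k G M f

theorem lift_single {M : Type*} [AddCommGroup M] [Module k M]
    (f : ∀ g : G, Θ.D g →ₗ[k] M) (g : G) (a : Θ.D g) : lift Θ f (single Θ g a) = f g a :=
  DirectSum.toModule_lof (M := fun g => Θ.D g) (φ := f) k g a

/-- The multiplication of the crossed product, the bilinear extension of `homogMul`. -/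
noncomputable def mulHom : Θ.CrossedProduct →ₗ[k] Θ.CrossedProduct →ₗ[k] Θ.CrossedProduct :=
  lift Θ fun g => LinearMap.flip <|
    lift Θ fun h => ((Θ.homogMul g h).compr₂ (single Θ (g * h))).flip

noncomputable instance : NonUnitalNonAssocRing Θ.CrossedProduct where
  mul x y := mulHom Θ x y
  left_distrib x y z := map_add (mulHom Θ x) y z
  right_distrib x y z := LinearMap.map_add₂ (mulHom Θ) x y z
  zero_mul x := LinearMap.map_zero₂ (mulHom Θ) x
  mul_zero x := map_zero (mulHom Θ x)

theorem single_mul_single (g h : G) (a : Θ.D g) (b : Θ.D h) :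
    single Θ g a * single Θ h b = single Θ (g * h) (Θ.homogMul g h a b) := by
  change mulHom Θ (single Θ g a) (single Θ h b) = _
  rw [mulHom, lift_single, LinearMap.flip_apply, lift_single, LinearMap.flip_apply,
    LinearMap.compr₂_apply]

end CrossedProduct

end TwistedPartialAction

/-- A grading of the `k`-algebra `B` by the group `G`. -/
structure GroupGrading (k G B : Type*) [CommRing k] [Group G] [DecidableEq G] [NonUnitalRing B]
    [Module k B] where
  comp : G → Submodule k B
  isInternal : DirectSum.IsInternal comp
  mul_mem : ∀ {g h : G} {a b : B}, a ∈ comp g → b ∈ comp h → a * b ∈ comp (g * h)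

/-- A ring is left `s`-unital if every `r` is of the form `y * r`, right `s`-unital if every `r` is
of the form `r * y`, and `s`-unital if it is both. -/
def IsSUnital (R : Type*) [NonUnitalRing R] : Prop :=
  (∀ r : R, ∃ y : R, y * r = r) ∧ (∀ r : R, ∃ y : R, r * y = r)

namespace GroupGrading

variable {k G B : Type*} [CommRing k] [Group G] [DecidableEq G] [NonUnitalRing B]
  [Module k B] (𝓑 : GroupGrading k G B)

/-- The subalgebra `B_1` of `B`. -/
def one : NonUnitalSubalgebra k B :=
  { 𝓑.comp 1 with
    mul_mem' := fun {a b} ha hb => by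
      have h : a * b ∈ 𝓑.comp (1 * 1) := 𝓑.mul_mem ha hb
      rw [one_mul] at h
      exact h }

theorem mulSpan_inv_le_one (g : G) : mulSpan (𝓑.comp g) (𝓑.comp g⁻¹) ≤ 𝓑.comp 1 :=
  mulSpan_le.2 fun a ha b hb => by
    have h := 𝓑.mul_mem ha hb
    rwa [mul_inv_cancel] at h

variable [IsScalarTower k B B] [SMulCommClass k B B]

/-- The subalgebra `D_g = B_g B_{g⁻¹}` of `B` (an ideal of `B_1`). -/
def D (g : G) : NonUnitalSubalgebra k B :=
  { mulSpan (𝓑.comp g) (𝓑.comp g⁻¹) with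
    mul_mem' := fun {x y} hx hy => by
      suffices h : mulSpan (𝓑.comp g) (𝓑.comp g⁻¹) ≤
          (mulSpan (𝓑.comp g) (𝓑.comp g⁻¹)).comap (LinearMap.mulRight k y) from h hx
      refine mulSpan_le.2 fun a ha b hb => ?_
      rw [Submodule.mem_comap, LinearMap.mulRight_apply, mul_assoc]
      refine mul_mem_mulSpan ha ?_
      have h := 𝓑.mul_mem hb (𝓑.mulSpan_inv_le_one g hy)
      rwa [mul_one] at h }

/-- `B` is isomorphic, as a graded algebra, to the crossed product by some twisted partial action
of `G` on `B_1`. -/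
def IsCrossedProduct : Prop :=
  ∃ (Θ : TwistedPartialAction k G 𝓑.one) (φ : B ≃ₗ[k] Θ.CrossedProduct),
    (∀ x y : B, φ (x * y) = φ x * φ y) ∧
      ∀ g : G, (𝓑.comp g).map (φ : B →ₗ[k] Θ.CrossedProduct) =
        LinearMap.range (TwistedPartialAction.CrossedProduct.single Θ g)

end GroupGrading

/-! Condition (ii) provides a formal unit `u_g` of degree `g` with `D_g u_g = B_g = u_g D_{g⁻¹}` and
`(d u_g) d' = d (u_g d')`. No such element need exist in `B`, but one can multiply by it. If `x ∈ B
D_g`, then `x = x e` for some `e ∈ D_g`, and `x u_g := x ψ_g(e)` does not depend on `e`; this is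
`rho`, and `lam` is its mirror image on `D_{g⁻¹} B`. The two satisfy `(x u_g) y = x (u_g y)`
(`rho_mul_eq_mul_lam`) and commute with each other (`lam_rho`). Both are injective, because `D_g =
u_g B_{g⁻¹}` and `D_{g⁻¹} = B_{g⁻¹} u_g`, so `u_g⁻¹` can be used as well. Domains are controlled by
`B_g D_h = D_{gh} B_g` (`mem_BD_iff_mem_DB`).

The twisted partial action is then forced: `θ_g(a) u_g = u_g a` and `w_{g,h} = u_g u_h u_{gh}⁻¹`.
Each axiom becomes an identity between words in the units after cancelling a `u` on the right, and
`a δ_g ↦ a u_g` is the isomorphism onto `B`.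

Conversely, in a crossed product `δ_g` plays the part of `u_g`. Since `D_g` is idempotent, `θ_g` is
onto and `w_{g,g⁻¹}` is invertible, the products `(D_g δ_g)(D_{g⁻¹} δ_{g⁻¹})` span exactly `D_g δ_1`
(`map_τ`). Condition (i) follows by idempotence, and `a δ_1 ↦ a δ_g` and `b δ_1 ↦ θ_g(b) δ_g` are
the isomorphisms of (ii). -/

set_option linter.unusedSectionVars false

/-! ### Common one-sided units in `s`-unital subalgebras. -/

section OneSidedUnits

variable {k B : Type*} [CommRing k] [NonUnitalRing B] [Module k B]
  [IsScalarTower k B B] [SMulCommClass k B B] {D : NonUnitalSubalgebra k B}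

/-- Two elements with right units in a right `s`-unital subalgebra have a common one. -/
theorem exists_common_right_unit (hD : ∀ d ∈ D, ∃ e ∈ D, d * e = d) {x y e f : B} (he : e ∈ D)
    (hf : f ∈ D) (hx : x * e = x) (hy : y * f = y) : ∃ u ∈ D, x * u = x ∧ y * u = y := by
  -- The unit `u` is chosen so that formally `1 - u = (1 - e)(1 - v)`. The first factor kills `x`,
  -- and it sends `y` to `y (f - f e)`, which the second kills.
  obtain ⟨v, hv, hfv⟩ := hD (f - f * e) (sub_mem hf (mul_mem hf he))
  refine ⟨e + v - e * v, sub_mem (add_mem he hv) (mul_mem he hv), ?_, ?_⟩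
  · rw [mul_sub, mul_add, ← mul_assoc, hx, add_sub_cancel_right]
  · have h : y * (f - f * e) * v = y * (f - f * e) := by rw [mul_assoc, hfv]
    rw [mul_sub, ← mul_assoc, hy, sub_mul] at h
    rw [mul_sub, mul_add, ← mul_assoc, add_sub_assoc, h, add_sub_cancel]

/-- Two elements with left units in a left `s`-unital subalgebra have a common one. -/
theorem exists_common_left_unit (hD : ∀ d ∈ D, ∃ e ∈ D, e * d = d) {x y e f : B} (he : e ∈ D)
    (hf : f ∈ D) (hx : e * x = x) (hy : f * y = y) : ∃ u ∈ D, u * x = x ∧ u * y = y := by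
  obtain ⟨v, hv, hfv⟩ := hD (f - e * f) (sub_mem hf (mul_mem he hf))
  refine ⟨e + v - v * e, sub_mem (add_mem he hv) (mul_mem hv he), ?_, ?_⟩
  · rw [sub_mul, add_mul, mul_assoc, hx, add_sub_cancel_right]
  · have h : v * ((f - e * f) * y) = (f - e * f) * y := by rw [← mul_assoc, hfv]
    rw [sub_mul, mul_assoc, hy, mul_sub] at h
    rw [sub_mul, add_mul, mul_assoc, add_sub_assoc, h, add_sub_cancel]

/-- Common units let a whole sum of products `a d` be fixed by a single element of `D`, so
membership in `B D` is witnessed by one unit. -/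
theorem mem_mulSpan_top_left_iff (hD : ∀ d ∈ D, ∃ e ∈ D, d * e = d) {x : B} :
    x ∈ mulSpan ⊤ D.toSubmodule ↔ ∃ e ∈ D, x * e = x := by
  refine ⟨fun hx => ?_, fun ⟨e, he, hx⟩ => hx ▸ mul_mem_mulSpan Submodule.mem_top he⟩
  refine Submodule.span_induction ?_ ?_ ?_ ?_ hx
  · rintro _ ⟨a, -, d, hd, rfl⟩
    obtain ⟨e, he, hde⟩ := hD d hd
    exact ⟨e, he, by rw [mul_assoc, hde]⟩
  · exact ⟨0, zero_mem D, zero_mul 0⟩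
  · rintro y z _ _ ⟨e, he, hy⟩ ⟨f, hf, hz⟩
    obtain ⟨u, hu, hyu, hzu⟩ := exists_common_right_unit hD he hf hy hz
    exact ⟨u, hu, by rw [add_mul, hyu, hzu]⟩
  · rintro c y _ ⟨e, he, hy⟩
    exact ⟨e, he, by rw [smul_mul_assoc, hy]⟩

theorem mem_mulSpan_top_right_iff (hD : ∀ d ∈ D, ∃ e ∈ D, e * d = d) {x : B} :
    x ∈ mulSpan D.toSubmodule ⊤ ↔ ∃ e ∈ D, e * x = x := by
  refine ⟨fun hx => ?_, fun ⟨e, he, hx⟩ => hx ▸ mul_mem_mulSpan he Submodule.mem_top⟩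
  refine Submodule.span_induction ?_ ?_ ?_ ?_ hx
  · rintro _ ⟨d, hd, a, -, rfl⟩
    obtain ⟨e, he, hde⟩ := hD d hd
    exact ⟨e, he, by rw [← mul_assoc, hde]⟩
  · exact ⟨0, zero_mem D, zero_mul 0⟩
  · rintro y z _ _ ⟨e, he, hy⟩ ⟨f, hf, hz⟩
    obtain ⟨u, hu, hyu, hzu⟩ := exists_common_left_unit hD he hf hy hz
    exact ⟨u, hu, by rw [mul_add, hyu, hzu]⟩
  · rintro c y _ ⟨e, he, hy⟩
    exact ⟨e, he, by rw [mul_smul_comm, hy]⟩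

end OneSidedUnits

/-! ### Multiplication by the formal units `u_g` and their inverses. -/

namespace GroupGrading

variable {k G B : Type*} [CommRing k] [Group G] [DecidableEq G] [NonUnitalRing B]
  [Module k B] [IsScalarTower k B B] [SMulCommClass k B B]

/-- The left ideal `B D_g`. -/
def BD (𝓑 : GroupGrading k G B) (g : G) : Submodule k B := mulSpan ⊤ (𝓑.D g).toSubmodule

/-- The right ideal `D_g B`. -/
def DB (𝓑 : GroupGrading k G B) (g : G) : Submodule k B := mulSpan (𝓑.D g).toSubmodule ⊤

/-- Isomorphisms `ψ g : D g ≃ B_g` of left modules and `ψ' g : D g⁻¹ ≃ B_g` of right modules,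
balanced and normalized at `1`, for a grading with `B_g B_{g⁻¹} B_g = B_g` and `s`-unital
`D g = B_g B_{g⁻¹}`. One thinks of `ψ g d` as `d u_g` and of `ψ' g d` as `u_g d` for a formal
homogeneous unit `u_g`. -/
structure LocalUnits (𝓑 : GroupGrading k G B) where
  sUnital : ∀ g : G, IsSUnital (𝓑.D g)
  regular : ∀ g : G, mulSpan (mulSpan (𝓑.comp g) (𝓑.comp g⁻¹)) (𝓑.comp g) = 𝓑.comp g
  ψ : ∀ g : G, 𝓑.D g ≃ₗ[k] 𝓑.comp g
  ψ' : ∀ g : G, 𝓑.D g⁻¹ ≃ₗ[k] 𝓑.comp g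
  ψ_mul : ∀ (g : G) (d x : 𝓑.D g), (ψ g (d * x) : B) = d * ψ g x
  ψ'_mul : ∀ (g : G) (x d : 𝓑.D g⁻¹), (ψ' g (x * d) : B) = ψ' g x * d
  balanced : ∀ (g : G) (d : 𝓑.D g) (d' : 𝓑.D g⁻¹), (ψ g d : B) * d' = d * ψ' g d'
  ψ_one : ∀ d : 𝓑.D 1, (ψ 1 d : B) = d
  ψ'_one : ∀ d : 𝓑.D (1 : G)⁻¹, (ψ' 1 d : B) = d

namespace LocalUnits

variable {𝓑 : GroupGrading k G B} (T : 𝓑.LocalUnits)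

theorem mul_mem_of_eq {g h p : G} {a b : B} (ha : a ∈ 𝓑.comp g) (hb : b ∈ 𝓑.comp h)
    (hp : g * h = p) : a * b ∈ 𝓑.comp p :=
  hp ▸ 𝓑.mul_mem ha hb

theorem mem_comp_one_of_mem_D {g : G} {x : B} (hx : x ∈ 𝓑.D g) : x ∈ 𝓑.comp 1 :=
  𝓑.mulSpan_inv_le_one g hx

theorem mul_mem_D_left {g : G} {a x : B} (ha : a ∈ 𝓑.comp 1) (hx : x ∈ 𝓑.D g) : a * x ∈ 𝓑.D g := by
  suffices h : mulSpan (𝓑.comp g) (𝓑.comp g⁻¹) ≤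
      (mulSpan (𝓑.comp g) (𝓑.comp g⁻¹)).comap (LinearMap.mulLeft k a) from h hx
  refine mulSpan_le.2 fun b hb c hc => ?_
  rw [Submodule.mem_comap, LinearMap.mulLeft_apply, ← mul_assoc]
  exact mul_mem_mulSpan (mul_mem_of_eq ha hb (one_mul g)) hc

theorem mul_mem_D_right {g : G} {a x : B} (hx : x ∈ 𝓑.D g) (ha : a ∈ 𝓑.comp 1) : x * a ∈ 𝓑.D g := by
  suffices h : mulSpan (𝓑.comp g) (𝓑.comp g⁻¹) ≤
      (mulSpan (𝓑.comp g) (𝓑.comp g⁻¹)).comap (LinearMap.mulRight k a) from h hx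
  refine mulSpan_le.2 fun b hb c hc => ?_
  rw [Submodule.mem_comap, LinearMap.mulRight_apply, mul_assoc]
  exact mul_mem_mulSpan hb (mul_mem_of_eq hc ha (mul_one _))

include T

theorem exists_right_unit {g : G} {d : B} (hd : d ∈ 𝓑.D g) : ∃ e ∈ 𝓑.D g, d * e = d := by
  obtain ⟨e, he⟩ := (T.sUnital g).2 ⟨d, hd⟩
  exact ⟨e, e.2, congrArg Subtype.val he⟩

theorem exists_left_unit {g : G} {d : B} (hd : d ∈ 𝓑.D g) : ∃ e ∈ 𝓑.D g, e * d = d := by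
  obtain ⟨e, he⟩ := (T.sUnital g).1 ⟨d, hd⟩
  exact ⟨e, e.2, congrArg Subtype.val he⟩


theorem mem_BD {g : G} {x : B} : x ∈ 𝓑.BD g ↔ ∃ e ∈ 𝓑.D g, x * e = x :=
  mem_mulSpan_top_left_iff fun _ hd => T.exists_right_unit hd

theorem mem_DB {g : G} {x : B} : x ∈ 𝓑.DB g ↔ ∃ e ∈ 𝓑.D g, e * x = x :=
  mem_mulSpan_top_right_iff fun _ hd => T.exists_left_unit hd

theorem mul_mem_BD {g : G} (b : B) {x : B} (hx : x ∈ 𝓑.BD g) : b * x ∈ 𝓑.BD g := by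
  obtain ⟨e, he, hxe⟩ := T.mem_BD.1 hx
  exact T.mem_BD.2 ⟨e, he, by rw [mul_assoc, hxe]⟩

theorem mul_mem_DB {g : G} {x : B} (b : B) (hx : x ∈ 𝓑.DB g) : x * b ∈ 𝓑.DB g := by
  obtain ⟨e, he, hxe⟩ := T.mem_DB.1 hx
  exact T.mem_DB.2 ⟨e, he, by rw [← mul_assoc, hxe]⟩

theorem D_le_BD {g : G} {x : B} (hx : x ∈ 𝓑.D g) : x ∈ 𝓑.BD g :=
  T.mem_BD.2 (T.exists_right_unit hx)

theorem D_le_DB {g : G} {x : B} (hx : x ∈ 𝓑.D g) : x ∈ 𝓑.DB g :=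
  T.mem_DB.2 (T.exists_left_unit hx)

theorem exists_common_right {g : G} {x y : B} (hx : x ∈ 𝓑.BD g) (hy : y ∈ 𝓑.BD g) :
    ∃ e ∈ 𝓑.D g, x * e = x ∧ y * e = y := by
  obtain ⟨e, he, hxe⟩ := T.mem_BD.1 hx
  obtain ⟨f, hf, hyf⟩ := T.mem_BD.1 hy
  exact exists_common_right_unit (fun _ hd => T.exists_right_unit hd) he hf hxe hyf

theorem exists_common_left {g : G} {x y : B} (hx : x ∈ 𝓑.DB g) (hy : y ∈ 𝓑.DB g) :
    ∃ e ∈ 𝓑.D g, e * x = x ∧ e * y = y := by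
  obtain ⟨e, he, hxe⟩ := T.mem_DB.1 hx
  obtain ⟨f, hf, hyf⟩ := T.mem_DB.1 hy
  exact exists_common_left_unit (fun _ hd => T.exists_left_unit hd) he hf hxe hyf

/-- `D_g` is an ideal of `B_1`, so `x = x e` already lies in it. Membership in `D_g` can thus be
tracked through one-sided ideals of `B`, which `rho` and `lam` respect. -/
theorem mem_D_iff_BD {g : G} {x : B} (hx : x ∈ 𝓑.comp 1) : x ∈ 𝓑.D g ↔ x ∈ 𝓑.BD g := by
  refine ⟨fun h => T.D_le_BD h, fun h => ?_⟩
  obtain ⟨e, he, hxe⟩ := T.mem_BD.1 h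
  exact hxe ▸ mul_mem_D_left hx he

theorem mem_D_iff_DB {g : G} {x : B} (hx : x ∈ 𝓑.comp 1) : x ∈ 𝓑.D g ↔ x ∈ 𝓑.DB g := by
  refine ⟨fun h => T.D_le_DB h, fun h => ?_⟩
  obtain ⟨e, he, hxe⟩ := T.mem_DB.1 h
  exact hxe ▸ mul_mem_D_right he hx

theorem comp_le_DB {g : G} {x : B} (hx : x ∈ 𝓑.comp g) : x ∈ 𝓑.DB g := by
  rw [← T.regular g] at hx
  exact mulSpan_mono le_rfl le_top hx

/-- Condition (i), bracketed as `B_g (B_{g⁻¹} B_g)`. The free index `h` allows the double inverse in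
`D_{g⁻¹}` to be simplified. -/
theorem comp_le_BD {g h : G} (hgh : g⁻¹ = h) {x : B} (hx : x ∈ 𝓑.comp g) : x ∈ 𝓑.BD h := by
  subst hgh
  rw [← T.regular g, mulSpan_assoc] at hx
  refine mulSpan_mono (T := mulSpan (𝓑.comp g⁻¹) (𝓑.comp g)) le_top ?_ hx
  change _ ≤ mulSpan (𝓑.comp g⁻¹) (𝓑.comp g⁻¹⁻¹)
  rw [inv_inv]

/-- `B_g D_h = D_{gh} B_g`. -/
theorem mem_BD_iff_mem_DB {g h p : G} (hp : g * h = p) {b : B} (hb : b ∈ 𝓑.comp g) :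
    b ∈ 𝓑.BD h ↔ b ∈ 𝓑.DB p := by
  subst hp
  constructor
  · intro hbh
    obtain ⟨e, he, hbe⟩ := T.mem_BD.1 hbh
    obtain ⟨f, hf, hbf⟩ := T.mem_BD.1 (T.comp_le_BD rfl hb)
    -- Now `b = b e f` lies in `b (B_h B_{h⁻¹})(B_{g⁻¹} B_g)`. Regrouping puts `(b B_h)(B_{h⁻¹}
    -- B_{g⁻¹})` in front, which is contained in `B_{gh} B_{(gh)⁻¹} = D_{gh}`.
    rw [← hbf, ← hbe, mul_assoc]
    have hef : e * f ∈ mulSpan (mulSpan (𝓑.comp h) (𝓑.comp h⁻¹))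
        (mulSpan (𝓑.comp g⁻¹) (𝓑.comp g⁻¹⁻¹)) := mul_mem_mulSpan he hf
    suffices H : mulSpan (mulSpan (𝓑.comp h) (𝓑.comp h⁻¹))
        (mulSpan (𝓑.comp g⁻¹) (𝓑.comp g⁻¹⁻¹)) ≤
        (𝓑.DB (g * h)).comap (LinearMap.mulLeft k b) from H hef
    rw [mulSpan_assoc, ← mulSpan_assoc (𝓑.comp h⁻¹), ← mulSpan_assoc]
    refine mulSpan_le.2 fun x hx c hc => ?_
    rw [Submodule.mem_comap, LinearMap.mulLeft_apply, ← mul_assoc]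
    refine mul_mem_mulSpan ?_ Submodule.mem_top
    suffices H : mulSpan (𝓑.comp h) (mulSpan (𝓑.comp h⁻¹) (𝓑.comp g⁻¹)) ≤
        (𝓑.D (g * h)).toSubmodule.comap (LinearMap.mulLeft k b) from H hx
    refine mulSpan_le.2 fun y hy z hz => ?_
    rw [Submodule.mem_comap, LinearMap.mulLeft_apply, ← mul_assoc]
    refine mul_mem_mulSpan (𝓑.mul_mem hb hy) ?_
    rw [mul_inv_rev]
    exact mulSpan_le.2 (fun _ hu _ hv => 𝓑.mul_mem hu hv) hz
  · intro hbh
    obtain ⟨e, he, hbe⟩ := T.mem_DB.1 hbh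
    obtain ⟨f, hf, hbf⟩ := T.mem_DB.1 (T.comp_le_DB hb)
    -- Now `b = f e b`, and the tail `(B_{g⁻¹} B_{gh})(B_{(gh)⁻¹} b)` is contained in `B_h B_{h⁻¹} =
    -- D_h`.
    rw [← hbf, ← hbe, ← mul_assoc]
    have hef : f * e ∈ mulSpan (mulSpan (𝓑.comp g) (𝓑.comp g⁻¹))
        (mulSpan (𝓑.comp (g * h)) (𝓑.comp (g * h)⁻¹)) := mul_mem_mulSpan hf he
    suffices H : mulSpan (mulSpan (𝓑.comp g) (𝓑.comp g⁻¹))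
        (mulSpan (𝓑.comp (g * h)) (𝓑.comp (g * h)⁻¹)) ≤
        (𝓑.BD h).comap (LinearMap.mulRight k b) from H hef
    rw [mulSpan_assoc, ← mulSpan_assoc (𝓑.comp g⁻¹)]
    refine mulSpan_le.2 fun c hc x hx => ?_
    rw [Submodule.mem_comap, LinearMap.mulRight_apply, mul_assoc]
    refine mul_mem_mulSpan Submodule.mem_top ?_
    suffices H : mulSpan (mulSpan (𝓑.comp g⁻¹) (𝓑.comp (g * h))) (𝓑.comp (g * h)⁻¹) ≤
        (𝓑.D h).toSubmodule.comap (LinearMap.mulRight k b) from H hx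
    refine mulSpan_le.2 fun y hy z hz => ?_
    rw [Submodule.mem_comap, LinearMap.mulRight_apply, mul_assoc]
    refine mul_mem_mulSpan ?_ (mul_mem_of_eq hz hb (by group))
    exact mulSpan_le.2 (fun _ hu _ hv => mul_mem_of_eq hu hv (by group)) hy


open Classical in
/-- Right multiplication by `u_g`, on the left ideal `B D_g` (and zero elsewhere). -/
noncomputable def rho (g : G) (x : B) : B :=
  if h : ∃ e : 𝓑.D g, x * e = x then x * T.ψ g h.choose else 0

open Classical in
/-- Left multiplication by `u_g`, on the right ideal `D_{g⁻¹} B` (and zero elsewhere). -/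
noncomputable def lam (g : G) (x : B) : B :=
  if h : ∃ e : 𝓑.D g⁻¹, e * x = x then T.ψ' g h.choose * x else 0

/-- Independence of the chosen unit: two right units `u` of `x` have a common right unit `f ∈ D_g`,
and `x ψ(u) = x ψ(u f) = x u ψ(f) = x ψ(f)`. -/
theorem rho_eq {g : G} {x e : B} (he : e ∈ 𝓑.D g) (hx : x * e = x) :
    T.rho g x = x * T.ψ g ⟨e, he⟩ := by
  have h : ∃ e : 𝓑.D g, x * e = x := ⟨⟨e, he⟩, hx⟩
  obtain ⟨f, hf, hef, hcf⟩ := T.exists_common_right (T.D_le_BD he) (T.D_le_BD h.choose.2)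
  have key : ∀ u : 𝓑.D g, x * u = x → (u : B) * f = u → x * (T.ψ g u : B) = x * T.ψ g ⟨f, hf⟩ := by
    intro u hxu huf
    have hu : u * ⟨f, hf⟩ = u := Subtype.ext huf
    rw [← hu, T.ψ_mul, ← mul_assoc, hxu]
  rw [rho, dif_pos h, key _ h.choose_spec hcf, key ⟨e, he⟩ hx hef]

theorem lam_eq {g : G} {x e : B} (he : e ∈ 𝓑.D g⁻¹) (hx : e * x = x) :
    T.lam g x = T.ψ' g ⟨e, he⟩ * x := by
  have h : ∃ e : 𝓑.D g⁻¹, e * x = x := ⟨⟨e, he⟩, hx⟩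
  obtain ⟨f, hf, hef, hcf⟩ := T.exists_common_left (T.D_le_DB he) (T.D_le_DB h.choose.2)
  have key : ∀ u : 𝓑.D g⁻¹, u * x = x → f * (u : B) = u →
      (T.ψ' g u : B) * x = T.ψ' g ⟨f, hf⟩ * x := by
    intro u hxu huf
    have hu : ⟨f, hf⟩ * u = u := Subtype.ext huf
    rw [← hu, T.ψ'_mul, mul_assoc, hxu]
  rw [lam, dif_pos h, key _ h.choose_spec hcf, key ⟨e, he⟩ hx hef]

theorem rho_coe {g : G} (d : 𝓑.D g) : T.rho g d = T.ψ g d := by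
  obtain ⟨e, he, hde⟩ := T.exists_right_unit d.2
  rw [T.rho_eq he hde, ← T.ψ_mul]
  exact congrArg (fun z => (T.ψ g z : B)) (Subtype.ext hde)

theorem lam_coe {g : G} (d : 𝓑.D g⁻¹) : T.lam g d = T.ψ' g d := by
  obtain ⟨e, he, hde⟩ := T.exists_left_unit d.2
  rw [T.lam_eq he hde, ← T.ψ'_mul]
  exact congrArg (fun z => (T.ψ' g z : B)) (Subtype.ext hde)

theorem rho_mul {g : G} (b : B) {x : B} (hx : x ∈ 𝓑.BD g) : T.rho g (b * x) = b * T.rho g x := by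
  obtain ⟨e, he, hxe⟩ := T.mem_BD.1 hx
  rw [T.rho_eq he hxe, T.rho_eq he (by rw [mul_assoc, hxe]), mul_assoc]

theorem lam_mul {g : G} {x : B} (b : B) (hx : x ∈ 𝓑.DB g⁻¹) : T.lam g (x * b) = T.lam g x * b := by
  obtain ⟨e, he, hxe⟩ := T.mem_DB.1 hx
  rw [T.lam_eq he hxe, T.lam_eq he (by rw [← mul_assoc, hxe]), mul_assoc]

theorem rho_add {g : G} {x y : B} (hx : x ∈ 𝓑.BD g) (hy : y ∈ 𝓑.BD g) :
    T.rho g (x + y) = T.rho g x + T.rho g y := by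
  obtain ⟨e, he, hxe, hye⟩ := T.exists_common_right hx hy
  rw [T.rho_eq he hxe, T.rho_eq he hye, T.rho_eq he (by rw [add_mul, hxe, hye]), add_mul]

theorem lam_add {g : G} {x y : B} (hx : x ∈ 𝓑.DB g⁻¹) (hy : y ∈ 𝓑.DB g⁻¹) :
    T.lam g (x + y) = T.lam g x + T.lam g y := by
  obtain ⟨e, he, hxe, hye⟩ := T.exists_common_left hx hy
  rw [T.lam_eq he hxe, T.lam_eq he hye, T.lam_eq he (by rw [mul_add, hxe, hye]), mul_add]

theorem rho_smul {g : G} (c : k) {x : B} (hx : x ∈ 𝓑.BD g) :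
    T.rho g (c • x) = c • T.rho g x := by
  obtain ⟨e, he, hxe⟩ := T.mem_BD.1 hx
  rw [T.rho_eq he hxe, T.rho_eq he (by rw [smul_mul_assoc, hxe]), smul_mul_assoc]

theorem lam_smul {g : G} (c : k) {x : B} (hx : x ∈ 𝓑.DB g⁻¹) :
    T.lam g (c • x) = c • T.lam g x := by
  obtain ⟨e, he, hxe⟩ := T.mem_DB.1 hx
  rw [T.lam_eq he hxe, T.lam_eq he (by rw [mul_smul_comm, hxe]), mul_smul_comm]

/-- With `x = x e` and `y = f y`, this is the balance condition `ψ(e) f = e ψ'(f)` multiplied by `x`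
and `y`. -/
theorem rho_mul_eq_mul_lam {g : G} {x y : B} (hx : x ∈ 𝓑.BD g) (hy : y ∈ 𝓑.DB g⁻¹) :
    T.rho g x * y = x * T.lam g y := by
  obtain ⟨e, he, hxe⟩ := T.mem_BD.1 hx
  obtain ⟨f, hf, hyf⟩ := T.mem_DB.1 hy
  have h := T.balanced g ⟨e, he⟩ ⟨f, hf⟩
  dsimp only at h
  rw [T.rho_eq he hxe, T.lam_eq hf hyf]
  nth_rewrite 1 [← hyf]
  nth_rewrite 2 [← hxe]
  rw [mul_assoc, ← mul_assoc _ f y, h]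
  simp only [mul_assoc]

theorem rho_mem_DB {g h : G} {x : B} (hx : x ∈ 𝓑.BD g) (hx' : x ∈ 𝓑.DB h) :
    T.rho g x ∈ 𝓑.DB h := by
  obtain ⟨e, he, hxe⟩ := T.mem_DB.1 hx'
  rw [← hxe, T.rho_mul _ hx]
  exact mul_mem_mulSpan he Submodule.mem_top

theorem lam_mem_BD {g h : G} {x : B} (hx : x ∈ 𝓑.DB g⁻¹) (hx' : x ∈ 𝓑.BD h) :
    T.lam g x ∈ 𝓑.BD h := by
  obtain ⟨e, he, hxe⟩ := T.mem_BD.1 hx'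
  rw [← hxe, T.lam_mul _ hx]
  exact mul_mem_mulSpan Submodule.mem_top he

theorem rho_mem_comp {g h p : G} (hp : h * g = p) {x : B} (hx : x ∈ 𝓑.BD g) (hx' : x ∈ 𝓑.comp h) :
    T.rho g x ∈ 𝓑.comp p := by
  obtain ⟨e, he, hxe⟩ := T.mem_BD.1 hx
  rw [T.rho_eq he hxe]
  exact mul_mem_of_eq hx' (T.ψ g _).2 hp

theorem lam_mem_comp {g h p : G} (hp : g * h = p) {x : B} (hx : x ∈ 𝓑.DB g⁻¹)
    (hx' : x ∈ 𝓑.comp h) : T.lam g x ∈ 𝓑.comp p := by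
  obtain ⟨e, he, hxe⟩ := T.mem_DB.1 hx
  rw [T.lam_eq he hxe]
  exact mul_mem_of_eq (T.ψ' g _).2 hx' hp

theorem lam_rho {g h : G} {x : B} (hx : x ∈ 𝓑.DB g⁻¹) (hx' : x ∈ 𝓑.BD h) :
    T.lam g (T.rho h x) = T.rho h (T.lam g x) := by
  obtain ⟨e, he, hxe⟩ := T.mem_BD.1 hx'
  obtain ⟨f, hf, hxf⟩ := T.mem_DB.1 hx
  rw [T.rho_eq he hxe, T.lam_mul _ hx, T.lam_eq hf hxf, T.rho_mul _ hx', T.rho_eq he hxe,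
    mul_assoc]

/-- `D_{g⁻¹}` is spanned by products `b c` with `c ∈ B_g`, and `c = d u_g` for some `d ∈ D_g`; hence
`b c = (b d) u_g`. This gives both surjectivity of `rho` and injectivity of `lam`. -/
theorem exists_rho_eq_of_mem_D {g : G} {e : B} (he : e ∈ 𝓑.D g⁻¹) :
    ∃ s ∈ 𝓑.comp g⁻¹, T.rho g s = e := by
  have hBD : ∀ s ∈ 𝓑.comp g⁻¹, s ∈ 𝓑.BD g := fun s hs => T.comp_le_BD (inv_inv g) hs
  refine Submodule.span_induction ?_ ?_ ?_ ?_ he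
  · rintro _ ⟨b, hb, c, hc, rfl⟩
    rw [inv_inv] at hc
    obtain ⟨d, hd⟩ := (T.ψ g).surjective ⟨c, hc⟩
    refine ⟨b * d, mul_mem_of_eq hb (mem_comp_one_of_mem_D d.2) (mul_one _), ?_⟩
    rw [T.rho_mul _ (T.D_le_BD d.2), T.rho_coe, hd]
  · refine ⟨0, zero_mem _, ?_⟩
    rw [T.rho_eq (zero_mem _) (mul_zero 0), zero_mul]
  · rintro x y _ _ ⟨s, hs, rfl⟩ ⟨t, ht, rfl⟩
    exact ⟨s + t, add_mem hs ht, T.rho_add (hBD s hs) (hBD t ht)⟩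
  · rintro c x _ ⟨s, hs, rfl⟩
    exact ⟨c • s, Submodule.smul_mem _ c hs, T.rho_smul c (hBD s hs)⟩

theorem exists_lam_eq_of_mem_D {g : G} {e : B} (he : e ∈ 𝓑.D g) :
    ∃ s ∈ 𝓑.comp g⁻¹, T.lam g s = e := by
  have hDB : ∀ s ∈ 𝓑.comp g⁻¹, s ∈ 𝓑.DB g⁻¹ := fun s hs => T.comp_le_DB hs
  refine Submodule.span_induction ?_ ?_ ?_ ?_ he
  · rintro _ ⟨c, hc, b, hb, rfl⟩
    obtain ⟨d, hd⟩ := (T.ψ' g).surjective ⟨c, hc⟩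
    refine ⟨d * b, mul_mem_of_eq (mem_comp_one_of_mem_D d.2) hb (one_mul _), ?_⟩
    rw [T.lam_mul _ (T.D_le_DB d.2), T.lam_coe, hd]
  · refine ⟨0, zero_mem _, ?_⟩
    rw [T.lam_eq (zero_mem _) (mul_zero 0), mul_zero]
  · rintro x y _ _ ⟨s, hs, rfl⟩ ⟨t, ht, rfl⟩
    exact ⟨s + t, add_mem hs ht, T.lam_add (hDB s hs) (hDB t ht)⟩
  · rintro c x _ ⟨s, hs, rfl⟩
    exact ⟨c • s, Submodule.smul_mem _ c hs, T.lam_smul c (hDB s hs)⟩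

/-- A right unit of `x` in `D_g` has the form `u_g s`, so `x = x (u_g s) = (x u_g) s` is recovered
from `x u_g`. -/
theorem rho_injOn (g : G) : Set.InjOn (T.rho g) (𝓑.BD g) := by
  intro x hx y hy hxy
  obtain ⟨e, he, hxe, hye⟩ := T.exists_common_right hx hy
  obtain ⟨s, hs, rfl⟩ := T.exists_lam_eq_of_mem_D he
  rw [← hxe, ← hye, ← T.rho_mul_eq_mul_lam hx (T.comp_le_DB hs),
    ← T.rho_mul_eq_mul_lam hy (T.comp_le_DB hs), hxy]

theorem lam_injOn (g : G) : Set.InjOn (T.lam g) (𝓑.DB g⁻¹) := by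
  intro x hx y hy hxy
  obtain ⟨e, he, hxe, hye⟩ := T.exists_common_left hx hy
  obtain ⟨s, hs, rfl⟩ := T.exists_rho_eq_of_mem_D he
  rw [← hxe, ← hye, T.rho_mul_eq_mul_lam (T.comp_le_BD (inv_inv g) hs) hx,
    T.rho_mul_eq_mul_lam (T.comp_le_BD (inv_inv g) hs) hy, hxy]

/-- Right multiplication by `u_g⁻¹`, on the left ideal `B D_{g⁻¹}`. -/
noncomputable def rhoInv (g : G) : B → B := Function.invFunOn (T.rho g) (𝓑.BD g)

/-- Left multiplication by `u_g⁻¹`, on the right ideal `D_g B`. -/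
noncomputable def lamInv (g : G) : B → B := Function.invFunOn (T.lam g) (𝓑.DB g⁻¹)

theorem rhoInv_rho {g : G} {x : B} (hx : x ∈ 𝓑.BD g) : T.rhoInv g (T.rho g x) = x :=
  (T.rho_injOn g).leftInvOn_invFunOn hx

theorem lamInv_lam {g : G} {x : B} (hx : x ∈ 𝓑.DB g⁻¹) : T.lamInv g (T.lam g x) = x :=
  (T.lam_injOn g).leftInvOn_invFunOn hx

/-- Writing a right unit of `y` as `s u_g` gives `y = (y s) u_g`. So `u_g⁻¹` acts on `y` as right
multiplication by a genuine element `s` of degree `g⁻¹`, which depends on `y`. -/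
theorem exists_rho_eq {g : G} {y : B} (hy : y ∈ 𝓑.BD g⁻¹) :
    ∃ s ∈ 𝓑.comp g⁻¹, y * s ∈ 𝓑.BD g ∧ T.rho g (y * s) = y := by
  obtain ⟨e, he, hye⟩ := T.mem_BD.1 hy
  obtain ⟨s, hs, rfl⟩ := T.exists_rho_eq_of_mem_D he
  have hs' := T.comp_le_BD (inv_inv g) hs
  exact ⟨s, hs, T.mul_mem_BD y hs', by rw [T.rho_mul _ hs', hye]⟩

theorem exists_lam_eq {g : G} {y : B} (hy : y ∈ 𝓑.DB g) :
    ∃ s ∈ 𝓑.comp g⁻¹, s * y ∈ 𝓑.DB g⁻¹ ∧ T.lam g (s * y) = y := by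
  obtain ⟨e, he, hye⟩ := T.mem_DB.1 hy
  obtain ⟨s, hs, rfl⟩ := T.exists_lam_eq_of_mem_D he
  have hs' := T.comp_le_DB hs
  exact ⟨s, hs, T.mul_mem_DB y hs', by rw [T.lam_mul _ hs', hye]⟩

theorem rhoInv_mem_BD {g : G} {y : B} (hy : y ∈ 𝓑.BD g⁻¹) : T.rhoInv g y ∈ 𝓑.BD g := by
  obtain ⟨s, -, hs, h⟩ := T.exists_rho_eq hy
  rw [← h, T.rhoInv_rho hs]
  exact hs

theorem lamInv_mem_DB {g : G} {y : B} (hy : y ∈ 𝓑.DB g) : T.lamInv g y ∈ 𝓑.DB g⁻¹ := by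
  obtain ⟨s, -, hs, h⟩ := T.exists_lam_eq hy
  rw [← h, T.lamInv_lam hs]
  exact hs

theorem rho_rhoInv {g : G} {y : B} (hy : y ∈ 𝓑.BD g⁻¹) : T.rho g (T.rhoInv g y) = y := by
  obtain ⟨s, -, hs, h⟩ := T.exists_rho_eq hy
  rw [← h, T.rhoInv_rho hs]

theorem lam_lamInv {g : G} {y : B} (hy : y ∈ 𝓑.DB g) : T.lam g (T.lamInv g y) = y := by
  obtain ⟨s, -, hs, h⟩ := T.exists_lam_eq hy
  rw [← h, T.lamInv_lam hs]

theorem rhoInv_mem_comp {g h p : G} (hp : h * g⁻¹ = p) {y : B} (hy : y ∈ 𝓑.BD g⁻¹)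
    (hy' : y ∈ 𝓑.comp h) : T.rhoInv g y ∈ 𝓑.comp p := by
  obtain ⟨s, hs, hys, h⟩ := T.exists_rho_eq hy
  rw [← h, T.rhoInv_rho hys]
  exact mul_mem_of_eq hy' hs hp

theorem lamInv_mem_comp {g h p : G} (hp : g⁻¹ * h = p) {y : B} (hy : y ∈ 𝓑.DB g)
    (hy' : y ∈ 𝓑.comp h) : T.lamInv g y ∈ 𝓑.comp p := by
  obtain ⟨s, hs, hys, h⟩ := T.exists_lam_eq hy
  rw [← h, T.lamInv_lam hys]
  exact mul_mem_of_eq hs hy' hp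

theorem rhoInv_mul {g : G} (b : B) {y : B} (hy : y ∈ 𝓑.BD g⁻¹) :
    T.rhoInv g (b * y) = b * T.rhoInv g y := by
  have h := T.rhoInv_mem_BD hy
  conv_lhs => rw [← T.rho_rhoInv hy]
  rw [← T.rho_mul b h, T.rhoInv_rho (T.mul_mem_BD b h)]

theorem lamInv_mul {g : G} {y : B} (b : B) (hy : y ∈ 𝓑.DB g) :
    T.lamInv g (y * b) = T.lamInv g y * b := by
  have h := T.lamInv_mem_DB hy
  conv_lhs => rw [← T.lam_lamInv hy]
  rw [← T.lam_mul b h, T.lamInv_lam (T.mul_mem_DB b h)]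

theorem rhoInv_mem_DB {g h : G} {y : B} (hy : y ∈ 𝓑.BD g⁻¹) (hy' : y ∈ 𝓑.DB h) :
    T.rhoInv g y ∈ 𝓑.DB h := by
  obtain ⟨e, he, hye⟩ := T.mem_DB.1 hy'
  rw [← hye, T.rhoInv_mul _ hy]
  exact mul_mem_mulSpan he Submodule.mem_top

theorem lamInv_mem_BD {g h : G} {y : B} (hy : y ∈ 𝓑.DB g) (hy' : y ∈ 𝓑.BD h) :
    T.lamInv g y ∈ 𝓑.BD h := by
  obtain ⟨e, he, hye⟩ := T.mem_BD.1 hy'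
  rw [← hye, T.lamInv_mul _ hy]
  exact mul_mem_mulSpan Submodule.mem_top he

theorem rhoInv_add {g : G} {x y : B} (hx : x ∈ 𝓑.BD g⁻¹) (hy : y ∈ 𝓑.BD g⁻¹) :
    T.rhoInv g (x + y) = T.rhoInv g x + T.rhoInv g y := by
  have hx' := T.rhoInv_mem_BD hx
  have hy' := T.rhoInv_mem_BD hy
  conv_lhs => rw [← T.rho_rhoInv hx, ← T.rho_rhoInv hy]
  rw [← T.rho_add hx' hy', T.rhoInv_rho (add_mem hx' hy')]

theorem lamInv_add {g : G} {x y : B} (hx : x ∈ 𝓑.DB g) (hy : y ∈ 𝓑.DB g) :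
    T.lamInv g (x + y) = T.lamInv g x + T.lamInv g y := by
  have hx' := T.lamInv_mem_DB hx
  have hy' := T.lamInv_mem_DB hy
  conv_lhs => rw [← T.lam_lamInv hx, ← T.lam_lamInv hy]
  rw [← T.lam_add hx' hy', T.lamInv_lam (add_mem hx' hy')]

theorem rhoInv_smul {g : G} (c : k) {x : B} (hx : x ∈ 𝓑.BD g⁻¹) :
    T.rhoInv g (c • x) = c • T.rhoInv g x := by
  have hx' := T.rhoInv_mem_BD hx
  conv_lhs => rw [← T.rho_rhoInv hx]
  rw [← T.rho_smul c hx', T.rhoInv_rho (Submodule.smul_mem _ c hx')]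

theorem lamInv_smul {g : G} (c : k) {x : B} (hx : x ∈ 𝓑.DB g) :
    T.lamInv g (c • x) = c • T.lamInv g x := by
  have hx' := T.lamInv_mem_DB hx
  conv_lhs => rw [← T.lam_lamInv hx]
  rw [← T.lam_smul c hx', T.lamInv_lam (Submodule.smul_mem _ c hx')]

theorem rho_one {x : B} (hx : x ∈ 𝓑.BD 1) : T.rho 1 x = x := by
  obtain ⟨e, he, hxe⟩ := T.mem_BD.1 hx
  rw [T.rho_eq he hxe, T.ψ_one, hxe]

theorem lam_one {x : B} (hx : x ∈ 𝓑.DB 1) : T.lam 1 x = x := by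
  rw [← inv_one] at hx
  obtain ⟨e, he, hxe⟩ := T.mem_DB.1 hx
  rw [T.lam_eq he hxe, T.ψ'_one, hxe]

end LocalUnits
end GroupGrading

/-! ### Invertible multipliers. -/

namespace Multiplier

variable {k A : Type*} [CommRing k] [NonUnitalRing A] [Module k A]

/-- A multiplier whose two components are bijective is invertible. -/
noncomputable def unitOfBijective (w : Multiplier k A) (hR : Function.Bijective w.R)
    (hL : Function.Bijective w.L) : (Multiplier k A)ˣ where
  val := w
  inv :=
    { R := (LinearEquiv.ofBijective w.R hR).symm
      L := (LinearEquiv.ofBijective w.L hL).symm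
      R_mul := fun a b => by
        apply hR.injective
        rw [w.R_mul]
        exact ((LinearEquiv.ofBijective w.R hR).apply_symm_apply _).trans
          (congrArg (a * ·) ((LinearEquiv.ofBijective w.R hR).apply_symm_apply b).symm)
      L_mul := fun a b => by
        apply hL.injective
        rw [w.L_mul]
        exact ((LinearEquiv.ofBijective w.L hL).apply_symm_apply _).trans
          (congrArg (· * b) ((LinearEquiv.ofBijective w.L hL).apply_symm_apply a).symm)
      balanced := fun a b => by
        have h := w.balanced ((LinearEquiv.ofBijective w.R hR).symm a)
          ((LinearEquiv.ofBijective w.L hL).symm b)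
        have h1 : w.R ((LinearEquiv.ofBijective w.R hR).symm a) = a :=
          (LinearEquiv.ofBijective w.R hR).apply_symm_apply a
        have h2 : w.L ((LinearEquiv.ofBijective w.L hL).symm b) = b :=
          (LinearEquiv.ofBijective w.L hL).apply_symm_apply b
        rw [h1, h2] at h
        exact h.symm }
  val_inv := by
    ext a
    · exact (LinearEquiv.ofBijective w.R hR).symm_apply_apply a
    · exact (LinearEquiv.ofBijective w.L hL).apply_symm_apply a
  inv_val := by
    ext a
    · exact (LinearEquiv.ofBijective w.R hR).apply_symm_apply a
    · exact (LinearEquiv.ofBijective w.L hL).symm_apply_apply a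

/-- Turns the conjugation axiom `θ_g θ_h(a) = w θ_{gh}(a) w⁻¹` into `w θ_{gh}(a) = θ_g θ_h(a) w`,
which avoids the inverse multiplier. -/
theorem inv_R_eq_of_eq_R (w : (Multiplier k A)ˣ) {a b : A} (h : b = w.val.R a) :
    w⁻¹.val.R b = a := by
  subst h
  exact congrArg (fun v : Multiplier k A => v.R a) w.mul_inv

end Multiplier

/-! ### The ideals, isomorphisms and twisting multipliers built from the `u_g`. -/

namespace GroupGrading

variable {k G B : Type*} [CommRing k] [Group G] [DecidableEq G] [NonUnitalRing B]
  [Module k B] [IsScalarTower k B B] [SMulCommClass k B B]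

/-- `D g`, as an ideal of `B_1`. -/
def ideal (𝓑 : GroupGrading k G B) (g : G) : AlgIdeal k 𝓑.one where
  carrier := {a | (a : B) ∈ 𝓑.D g}
  add_mem' := fun ha hb => (𝓑.D g).add_mem' ha hb
  zero_mem' := zero_mem (𝓑.D g)
  smul_mem' := fun c _ ha => (𝓑.D g).smul_mem' c ha
  mul_mem_left' := fun a _ hx => LocalUnits.mul_mem_D_left a.2 hx
  mul_mem_right' := fun a hx => LocalUnits.mul_mem_D_right hx a.2

variable {𝓑 : GroupGrading k G B}

theorem mem_ideal {g : G} {a : 𝓑.one} : a ∈ 𝓑.ideal g ↔ (a : B) ∈ 𝓑.D g := Iff.rfl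

/-- The ideal `D g` of `B_1` is the subalgebra `D g` of `B`. -/
def idealEquiv (𝓑 : GroupGrading k G B) (g : G) : 𝓑.ideal g ≃ₗ[k] 𝓑.D g where
  toFun a := ⟨a, a.2⟩
  invFun d := ⟨⟨d, LocalUnits.mem_comp_one_of_mem_D d.2⟩, d.2⟩
  map_add' _ _ := rfl
  map_smul' _ _ := rfl
  left_inv _ := rfl
  right_inv _ := rfl

namespace LocalUnits

variable (T : 𝓑.LocalUnits)

include T

/-- By `s`-unitality products of these ideals are intersections: `a = e a` with `e ∈ D_g`.
Idempotence and commutation of the ideals are then immediate. -/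
theorem mem_ideal_mul {g h : G} {a : 𝓑.one} :
    a ∈ 𝓑.ideal g * 𝓑.ideal h ↔ (a : B) ∈ 𝓑.D g ∧ (a : B) ∈ 𝓑.D h := by
  refine ⟨fun ha => ⟨AlgIdeal.mem_left_of_mem_mul ha, AlgIdeal.mem_right_of_mem_mul ha⟩, ?_⟩
  rintro ⟨hg, hh⟩
  obtain ⟨e, he, hea⟩ := T.exists_left_unit hg
  have h : (⟨e, mem_comp_one_of_mem_D he⟩ : 𝓑.one) * a = a := Subtype.ext hea
  rw [← h]
  exact AlgIdeal.mul_mem_mul (mem_ideal.2 he) (mem_ideal.2 hh)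

/-- The element of the ideal `D g * D h` given by an element of `D g ∩ D h`. -/
def mkMul {g h : G} (x : B) (hg : x ∈ 𝓑.D g) (hh : x ∈ 𝓑.D h) : ↥(𝓑.ideal g * 𝓑.ideal h) :=
  ⟨⟨x, mem_comp_one_of_mem_D hg⟩, T.mem_ideal_mul.2 ⟨hg, hh⟩⟩

theorem coe_mem_left {g h : G} (x : ↥(𝓑.ideal g * 𝓑.ideal h)) : ((x : 𝓑.one) : B) ∈ 𝓑.D g :=
  (T.mem_ideal_mul.1 x.2).1

theorem coe_mem_right {g h : G} (x : ↥(𝓑.ideal g * 𝓑.ideal h)) : ((x : 𝓑.one) : B) ∈ 𝓑.D h :=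
  (T.mem_ideal_mul.1 x.2).2

/-- Conjugation by `u_g`. -/
def θ (g : G) : 𝓑.ideal g⁻¹ ≃ₗ[k] 𝓑.ideal g :=
  ((𝓑.idealEquiv g⁻¹).trans (T.ψ' g)).trans ((T.ψ g).symm.trans (𝓑.idealEquiv g).symm)

/-- The relation `θ_g(a) u_g = u_g a`. As `rho` is injective on `B D_g`, it determines `θ_g(a)`, and
the later arguments use it in place of the definition. -/
theorem rho_θ (g : G) (a : 𝓑.ideal g⁻¹) :
    T.rho g ((T.θ g a : 𝓑.one) : B) = T.lam g ((a : 𝓑.one) : B) := by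
  have h1 := T.rho_coe (𝓑.idealEquiv g (T.θ g a))
  have h2 := T.lam_coe (𝓑.idealEquiv g⁻¹ a)
  have h3 : T.ψ g (𝓑.idealEquiv g (T.θ g a)) = T.ψ' g (𝓑.idealEquiv g⁻¹ a) := by
    simp [θ]
  rw [h3, ← h2] at h1
  exact h1

/-- `x u_g` lies in `B_g` and in `D_{gh} B`, hence in `B D_h`. So `u_h` may be applied next. -/
theorem rho_mem_BD_of_mem {g h : G} {x : B} (hg : x ∈ 𝓑.D g) (hgh : x ∈ 𝓑.D (g * h)) :
    T.rho g x ∈ 𝓑.BD h :=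
  (T.mem_BD_iff_mem_DB rfl (T.rho_mem_comp (one_mul g) (T.D_le_BD hg)
    (mem_comp_one_of_mem_D hg))).2 (T.rho_mem_DB (T.D_le_BD hg) (T.D_le_DB hgh))

theorem rho_rho_mem_comp {g h : G} {x : B} (hg : x ∈ 𝓑.D g) (hgh : x ∈ 𝓑.D (g * h)) :
    T.rho h (T.rho g x) ∈ 𝓑.comp (g * h) :=
  T.rho_mem_comp rfl (T.rho_mem_BD_of_mem hg hgh)
    (T.rho_mem_comp (one_mul g) (T.D_le_BD hg) (mem_comp_one_of_mem_D hg))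

theorem rho_rho_mem_BD {g h : G} {x : B} (hg : x ∈ 𝓑.D g) (hgh : x ∈ 𝓑.D (g * h)) :
    T.rho h (T.rho g x) ∈ 𝓑.BD (g * h)⁻¹ :=
  T.comp_le_BD rfl (T.rho_rho_mem_comp hg hgh)

/-- Right multiplication by `u_g u_h u_{gh}⁻¹`. -/
noncomputable def twistR (g h : G) (x : B) : B := T.rhoInv (g * h) (T.rho h (T.rho g x))

theorem rho_twistR {g h : G} {x : B} (hg : x ∈ 𝓑.D g) (hgh : x ∈ 𝓑.D (g * h)) :
    T.rho (g * h) (T.twistR g h x) = T.rho h (T.rho g x) :=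
  T.rho_rhoInv (T.rho_rho_mem_BD hg hgh)

theorem twistR_mem_DB {g h p : G} {x : B} (hg : x ∈ 𝓑.D g) (hgh : x ∈ 𝓑.D (g * h))
    (hp : x ∈ 𝓑.DB p) : T.twistR g h x ∈ 𝓑.DB p :=
  T.rhoInv_mem_DB (T.rho_rho_mem_BD hg hgh)
    (T.rho_mem_DB (T.rho_mem_BD_of_mem hg hgh) (T.rho_mem_DB (T.D_le_BD hg) hp))

theorem twistR_mem_comp {g h : G} {x : B} (hg : x ∈ 𝓑.D g) (hgh : x ∈ 𝓑.D (g * h)) :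
    T.twistR g h x ∈ 𝓑.comp 1 :=
  T.rhoInv_mem_comp (mul_inv_cancel _) (T.rho_rho_mem_BD hg hgh) (T.rho_rho_mem_comp hg hgh)

theorem twistR_mem_D {g h p : G} {x : B} (hg : x ∈ 𝓑.D g) (hgh : x ∈ 𝓑.D (g * h))
    (hp : x ∈ 𝓑.D p) : T.twistR g h x ∈ 𝓑.D p :=
  (T.mem_D_iff_DB (T.twistR_mem_comp hg hgh)).2 (T.twistR_mem_DB hg hgh (T.D_le_DB hp))

theorem twistR_mul {g h : G} (b : B) {x : B} (hg : x ∈ 𝓑.D g) (hgh : x ∈ 𝓑.D (g * h)) :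
    T.twistR g h (b * x) = b * T.twistR g h x := by
  rw [twistR, T.rho_mul b (T.D_le_BD hg), T.rho_mul b (T.rho_mem_BD_of_mem hg hgh),
    T.rhoInv_mul b (T.rho_rho_mem_BD hg hgh), twistR]

theorem twistR_add {g h : G} {x y : B} (hg : x ∈ 𝓑.D g) (hgh : x ∈ 𝓑.D (g * h))
    (hg' : y ∈ 𝓑.D g) (hgh' : y ∈ 𝓑.D (g * h)) :
    T.twistR g h (x + y) = T.twistR g h x + T.twistR g h y := by
  rw [twistR, T.rho_add (T.D_le_BD hg) (T.D_le_BD hg'),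
    T.rho_add (T.rho_mem_BD_of_mem hg hgh) (T.rho_mem_BD_of_mem hg' hgh'),
    T.rhoInv_add (T.rho_rho_mem_BD hg hgh) (T.rho_rho_mem_BD hg' hgh'), twistR, twistR]

theorem twistR_smul {g h : G} (c : k) {x : B} (hg : x ∈ 𝓑.D g) (hgh : x ∈ 𝓑.D (g * h)) :
    T.twistR g h (c • x) = c • T.twistR g h x := by
  rw [twistR, T.rho_smul c (T.D_le_BD hg), T.rho_smul c (T.rho_mem_BD_of_mem hg hgh),
    T.rhoInv_smul c (T.rho_rho_mem_BD hg hgh), twistR]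

theorem twistR_inj {g h : G} {x y : B} (hg : x ∈ 𝓑.D g) (hgh : x ∈ 𝓑.D (g * h))
    (hg' : y ∈ 𝓑.D g) (hgh' : y ∈ 𝓑.D (g * h)) (hxy : T.twistR g h x = T.twistR g h y) :
    x = y := by
  apply T.rho_injOn g (T.D_le_BD hg) (T.D_le_BD hg')
  apply T.rho_injOn h (T.rho_mem_BD_of_mem hg hgh) (T.rho_mem_BD_of_mem hg' hgh')
  rw [← T.rho_twistR hg hgh, hxy, T.rho_twistR hg' hgh']

/-- The preimage is `y u_{gh} u_h⁻¹ u_g⁻¹`. The first inverse applies because `y u_{gh}` has degree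
`gh` and lies in `D_g B`, hence in `B D_{h⁻¹}`. -/
theorem exists_twistR_eq {g h : G} {y : B} (hg : y ∈ 𝓑.D g) (hgh : y ∈ 𝓑.D (g * h)) :
    ∃ x ∈ 𝓑.D g, x ∈ 𝓑.D (g * h) ∧ T.twistR g h x = y := by
  have h1 : T.rho (g * h) y ∈ 𝓑.comp (g * h) :=
    T.rho_mem_comp (one_mul _) (T.D_le_BD hgh) (mem_comp_one_of_mem_D hg)
  have h2 : ∀ {p : G}, y ∈ 𝓑.D p → T.rho (g * h) y ∈ 𝓑.DB p := fun hp =>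
    T.rho_mem_DB (T.D_le_BD hgh) (T.D_le_DB hp)
  have h3 : T.rho (g * h) y ∈ 𝓑.BD h⁻¹ :=
    (T.mem_BD_iff_mem_DB (mul_inv_cancel_right g h) h1).2 (h2 hg)
  have h4 : T.rhoInv h (T.rho (g * h) y) ∈ 𝓑.comp g :=
    T.rhoInv_mem_comp (mul_inv_cancel_right g h) h3 h1
  have h5 : T.rhoInv h (T.rho (g * h) y) ∈ 𝓑.BD g⁻¹ := T.comp_le_BD rfl h4
  have h6 : T.rhoInv g (T.rhoInv h (T.rho (g * h) y)) ∈ 𝓑.comp 1 :=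
    T.rhoInv_mem_comp (mul_inv_cancel g) h5 h4
  have h7 : ∀ {p : G}, y ∈ 𝓑.D p → T.rhoInv g (T.rhoInv h (T.rho (g * h) y)) ∈ 𝓑.D p := fun hp =>
    (T.mem_D_iff_DB h6).2 (T.rhoInv_mem_DB h5 (T.rhoInv_mem_DB h3 (h2 hp)))
  refine ⟨_, h7 hg, h7 hgh, ?_⟩
  rw [twistR, T.rho_rhoInv h5, T.rho_rhoInv h3, T.rhoInv_rho (T.D_le_BD hgh)]

theorem lamInv_mem_DB_of_mem {g h : G} {x : B} (hg : x ∈ 𝓑.D g) (hgh : x ∈ 𝓑.D (g * h)) :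
    T.lamInv (g * h) x ∈ 𝓑.DB h⁻¹ :=
  (T.mem_BD_iff_mem_DB (by group) (T.lamInv_mem_comp (mul_one _) (T.D_le_DB hgh)
    (mem_comp_one_of_mem_D hg))).1 (T.lamInv_mem_BD (T.D_le_DB hgh) (T.D_le_BD hg))

theorem lam_lamInv_mem_comp {g h : G} {x : B} (hg : x ∈ 𝓑.D g) (hgh : x ∈ 𝓑.D (g * h)) :
    T.lam h (T.lamInv (g * h) x) ∈ 𝓑.comp g⁻¹ :=
  T.lam_mem_comp (h := (g * h)⁻¹) (by group) (T.lamInv_mem_DB_of_mem hg hgh)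
    (T.lamInv_mem_comp (mul_one _) (T.D_le_DB hgh) (mem_comp_one_of_mem_D hg))

/-- Left multiplication by `u_g u_h u_{gh}⁻¹`. -/
noncomputable def twistL (g h : G) (x : B) : B := T.lam g (T.lam h (T.lamInv (g * h) x))

theorem twistL_mem_BD {g h p : G} {x : B} (hg : x ∈ 𝓑.D g) (hgh : x ∈ 𝓑.D (g * h))
    (hp : x ∈ 𝓑.BD p) : T.twistL g h x ∈ 𝓑.BD p :=
  T.lam_mem_BD (T.comp_le_DB (T.lam_lamInv_mem_comp hg hgh))
    (T.lam_mem_BD (T.lamInv_mem_DB_of_mem hg hgh) (T.lamInv_mem_BD (T.D_le_DB hgh) hp))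

theorem twistL_mem_comp {g h : G} {x : B} (hg : x ∈ 𝓑.D g) (hgh : x ∈ 𝓑.D (g * h)) :
    T.twistL g h x ∈ 𝓑.comp 1 :=
  T.lam_mem_comp (mul_inv_cancel g) (T.comp_le_DB (T.lam_lamInv_mem_comp hg hgh))
    (T.lam_lamInv_mem_comp hg hgh)

theorem twistL_mem_D {g h p : G} {x : B} (hg : x ∈ 𝓑.D g) (hgh : x ∈ 𝓑.D (g * h))
    (hp : x ∈ 𝓑.D p) : T.twistL g h x ∈ 𝓑.D p :=
  (T.mem_D_iff_BD (T.twistL_mem_comp hg hgh)).2 (T.twistL_mem_BD hg hgh (T.D_le_BD hp))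

theorem twistL_mul {g h : G} {x : B} (b : B) (hg : x ∈ 𝓑.D g) (hgh : x ∈ 𝓑.D (g * h)) :
    T.twistL g h (x * b) = T.twistL g h x * b := by
  rw [twistL, T.lamInv_mul b (T.D_le_DB hgh), T.lam_mul b (T.lamInv_mem_DB_of_mem hg hgh),
    T.lam_mul b (T.comp_le_DB (T.lam_lamInv_mem_comp hg hgh)), twistL]

theorem twistL_add {g h : G} {x y : B} (hg : x ∈ 𝓑.D g) (hgh : x ∈ 𝓑.D (g * h))
    (hg' : y ∈ 𝓑.D g) (hgh' : y ∈ 𝓑.D (g * h)) :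
    T.twistL g h (x + y) = T.twistL g h x + T.twistL g h y := by
  rw [twistL, T.lamInv_add (T.D_le_DB hgh) (T.D_le_DB hgh'),
    T.lam_add (T.lamInv_mem_DB_of_mem hg hgh) (T.lamInv_mem_DB_of_mem hg' hgh'),
    T.lam_add (T.comp_le_DB (T.lam_lamInv_mem_comp hg hgh))
      (T.comp_le_DB (T.lam_lamInv_mem_comp hg' hgh')), twistL, twistL]

theorem twistL_smul {g h : G} (c : k) {x : B} (hg : x ∈ 𝓑.D g) (hgh : x ∈ 𝓑.D (g * h)) :
    T.twistL g h (c • x) = c • T.twistL g h x := by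
  rw [twistL, T.lamInv_smul c (T.D_le_DB hgh), T.lam_smul c (T.lamInv_mem_DB_of_mem hg hgh),
    T.lam_smul c (T.comp_le_DB (T.lam_lamInv_mem_comp hg hgh)), twistL]

theorem twistL_inj {g h : G} {x y : B} (hg : x ∈ 𝓑.D g) (hgh : x ∈ 𝓑.D (g * h))
    (hg' : y ∈ 𝓑.D g) (hgh' : y ∈ 𝓑.D (g * h)) (hxy : T.twistL g h x = T.twistL g h y) :
    x = y := by
  have h1 := T.lam_injOn g (T.comp_le_DB (T.lam_lamInv_mem_comp hg hgh))
    (T.comp_le_DB (T.lam_lamInv_mem_comp hg' hgh')) hxy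
  have h2 := T.lam_injOn h (T.lamInv_mem_DB_of_mem hg hgh) (T.lamInv_mem_DB_of_mem hg' hgh') h1
  rw [← T.lam_lamInv (T.D_le_DB hgh), h2, T.lam_lamInv (T.D_le_DB hgh')]

theorem exists_twistL_eq {g h : G} {y : B} (hg : y ∈ 𝓑.D g) (hgh : y ∈ 𝓑.D (g * h)) :
    ∃ x ∈ 𝓑.D g, x ∈ 𝓑.D (g * h) ∧ T.twistL g h x = y := by
  have h1 : T.lamInv g y ∈ 𝓑.comp g⁻¹ :=
    T.lamInv_mem_comp (mul_one _) (T.D_le_DB hg) (mem_comp_one_of_mem_D hg)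
  have h2 : ∀ {p : G}, y ∈ 𝓑.D p → T.lamInv g y ∈ 𝓑.BD p := fun hp =>
    T.lamInv_mem_BD (T.D_le_DB hg) (T.D_le_BD hp)
  have h3 : T.lamInv g y ∈ 𝓑.DB h :=
    (T.mem_BD_iff_mem_DB (inv_mul_cancel_left g h) h1).1 (h2 hgh)
  have h4 : T.lamInv h (T.lamInv g y) ∈ 𝓑.comp (g * h)⁻¹ :=
    T.lamInv_mem_comp (mul_inv_rev g h).symm h3 h1
  have h5 : T.lamInv h (T.lamInv g y) ∈ 𝓑.DB (g * h)⁻¹ := T.comp_le_DB h4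
  have h6 : T.lam (g * h) (T.lamInv h (T.lamInv g y)) ∈ 𝓑.comp 1 :=
    T.lam_mem_comp (mul_inv_cancel (g * h)) h5 h4
  have h7 : ∀ {p : G}, y ∈ 𝓑.D p → T.lam (g * h) (T.lamInv h (T.lamInv g y)) ∈ 𝓑.D p := fun hp =>
    (T.mem_D_iff_BD h6).2 (T.lam_mem_BD h5 (T.lamInv_mem_BD h3 (h2 hp)))
  refine ⟨_, h7 hg, h7 hgh, ?_⟩
  rw [twistL, T.lamInv_lam h5, T.lam_lamInv h3, T.lam_lamInv (T.D_le_DB hg)]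

/-- Write `y = u_{gh} c`. Moving the units across the product one at a time brings both sides to `x
u_g u_h c`. -/
theorem twistR_mul_eq_mul_twistL {g h : G} {x y : B} (hg : x ∈ 𝓑.D g) (hgh : x ∈ 𝓑.D (g * h))
    (hg' : y ∈ 𝓑.D g) (hgh' : y ∈ 𝓑.D (g * h)) :
    T.twistR g h x * y = x * T.twistL g h y := by
  conv_lhs => rw [← T.lam_lamInv (T.D_le_DB hgh')]
  rw [← T.rho_mul_eq_mul_lam (T.D_le_BD (T.twistR_mem_D hg hgh hgh))
      (T.lamInv_mem_DB (T.D_le_DB hgh')), T.rho_twistR hg hgh,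
    T.rho_mul_eq_mul_lam (T.rho_mem_BD_of_mem hg hgh) (T.lamInv_mem_DB_of_mem hg' hgh'),
    T.rho_mul_eq_mul_lam (T.D_le_BD hg) (T.comp_le_DB (T.lam_lamInv_mem_comp hg' hgh')), twistL]

/-- The multiplier `u_g u_h u_{gh}⁻¹` of `D g * D (g * h)`. -/
noncomputable def twist (g h : G) : Multiplier k ↥(𝓑.ideal g * 𝓑.ideal (g * h)) where
  R :=
    { toFun := fun x => T.mkMul (T.twistR g h ((x : 𝓑.one) : B))
        (T.twistR_mem_D (T.coe_mem_left x) (T.coe_mem_right x) (T.coe_mem_left x))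
        (T.twistR_mem_D (T.coe_mem_left x) (T.coe_mem_right x) (T.coe_mem_right x))
      map_add' := fun x y => Subtype.ext <| Subtype.ext <|
        T.twistR_add (T.coe_mem_left x) (T.coe_mem_right x) (T.coe_mem_left y) (T.coe_mem_right y)
      map_smul' := fun c x => Subtype.ext <| Subtype.ext <|
        T.twistR_smul c (T.coe_mem_left x) (T.coe_mem_right x) }
  L :=
    { toFun := fun x => T.mkMul (T.twistL g h ((x : 𝓑.one) : B))
        (T.twistL_mem_D (T.coe_mem_left x) (T.coe_mem_right x) (T.coe_mem_left x))
        (T.twistL_mem_D (T.coe_mem_left x) (T.coe_mem_right x) (T.coe_mem_right x))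
      map_add' := fun x y => Subtype.ext <| Subtype.ext <|
        T.twistL_add (T.coe_mem_left x) (T.coe_mem_right x) (T.coe_mem_left y) (T.coe_mem_right y)
      map_smul' := fun c x => Subtype.ext <| Subtype.ext <|
        T.twistL_smul c (T.coe_mem_left x) (T.coe_mem_right x) }
  R_mul := fun _ y => Subtype.ext <| Subtype.ext <|
    T.twistR_mul _ (T.coe_mem_left y) (T.coe_mem_right y)
  L_mul := fun x _ => Subtype.ext <| Subtype.ext <|
    T.twistL_mul _ (T.coe_mem_left x) (T.coe_mem_right x)
  balanced := fun x y => Subtype.ext <| Subtype.ext <|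
    T.twistR_mul_eq_mul_twistL (T.coe_mem_left x) (T.coe_mem_right x) (T.coe_mem_left y)
      (T.coe_mem_right y)

theorem coe_twist_R (g h : G) (x : ↥(𝓑.ideal g * 𝓑.ideal (g * h))) :
    (((T.twist g h).R x : 𝓑.one) : B) = T.twistR g h ((x : 𝓑.one) : B) := rfl

theorem coe_twist_L (g h : G) (x : ↥(𝓑.ideal g * 𝓑.ideal (g * h))) :
    (((T.twist g h).L x : 𝓑.one) : B) = T.twistL g h ((x : 𝓑.one) : B) := rfl

theorem twist_R_bijective (g h : G) : Function.Bijective (T.twist g h).R := by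
  refine ⟨fun x y hxy => Subtype.ext <| Subtype.ext ?_, fun y => ?_⟩
  · refine T.twistR_inj (T.coe_mem_left x) (T.coe_mem_right x) (T.coe_mem_left y)
      (T.coe_mem_right y) ?_
    rw [← coe_twist_R, hxy, coe_twist_R]
  · obtain ⟨x, hg, hgh, hx⟩ := T.exists_twistR_eq (T.coe_mem_left y) (T.coe_mem_right y)
    exact ⟨T.mkMul x hg hgh, Subtype.ext <| Subtype.ext hx⟩

theorem twist_L_bijective (g h : G) : Function.Bijective (T.twist g h).L := by
  refine ⟨fun x y hxy => Subtype.ext <| Subtype.ext ?_, fun y => ?_⟩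
  · refine T.twistL_inj (T.coe_mem_left x) (T.coe_mem_right x) (T.coe_mem_left y)
      (T.coe_mem_right y) ?_
    rw [← coe_twist_L, hxy, coe_twist_L]
  · obtain ⟨x, hg, hgh, hx⟩ := T.exists_twistL_eq (T.coe_mem_left y) (T.coe_mem_right y)
    exact ⟨T.mkMul x hg hgh, Subtype.ext <| Subtype.ext hx⟩

/-- The invertible multiplier `u_g u_h u_{gh}⁻¹` of `D g * D (g * h)`. -/
noncomputable def w (g h : G) : (Multiplier k ↥(𝓑.ideal g * 𝓑.ideal (g * h)))ˣ :=
  (T.twist g h).unitOfBijective (T.twist_R_bijective g h) (T.twist_L_bijective g h)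

theorem D_le_D_one {g : G} {x : B} (hx : x ∈ 𝓑.D g) : x ∈ 𝓑.D 1 :=
  (T.mem_D_iff_DB (mem_comp_one_of_mem_D hx)).2 (T.comp_le_DB (mem_comp_one_of_mem_D hx))

/-- The element `u_g a = θ_g(a) u_g` of `B_g` lies in `B D_h` exactly when `a ∈ D_h`, and in `D_{gh}
B` exactly when `θ_g(a) ∈ D_{gh}`. For elements of `B_g` these two conditions agree. -/
theorem θ_mem_D_iff {g h : G} (a : 𝓑.ideal g⁻¹) :
    ((T.θ g a : 𝓑.one) : B) ∈ 𝓑.D (g * h) ↔ ((a : 𝓑.one) : B) ∈ 𝓑.D h := by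
  have ha : ((a : 𝓑.one) : B) ∈ 𝓑.D g⁻¹ := a.2
  have hθ : ((T.θ g a : 𝓑.one) : B) ∈ 𝓑.D g := (T.θ g a).2
  have h1 : T.lam g ((a : 𝓑.one) : B) ∈ 𝓑.comp g :=
    T.lam_mem_comp (mul_one g) (T.D_le_DB ha) (a : 𝓑.one).2
  have h2 := T.rho_θ g a
  have h3 := T.mem_BD_iff_mem_DB (h := h) rfl h1
  rw [T.mem_D_iff_DB (T.θ g a : 𝓑.one).2, T.mem_D_iff_BD (a : 𝓑.one).2]
  constructor
  · intro h
    have h4 := T.lamInv_mem_BD (T.comp_le_DB h1)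
      (h3.2 (h2 ▸ T.rho_mem_DB (T.D_le_BD hθ) h))
    rwa [T.lamInv_lam (T.D_le_DB ha)] at h4
  · intro h
    have h4 := T.rhoInv_mem_DB (T.comp_le_BD rfl h1) (h3.1 (T.lam_mem_BD (T.D_le_DB ha) h))
    rwa [← h2, T.rhoInv_rho (T.D_le_BD hθ)] at h4

/-- Cancel `u_g` from `θ_g(a) θ_g(b) u_g = θ_g(a) u_g b = u_g a b`. The balance condition enters in
`θ_g(a) (u_g b) = (θ_g(a) u_g) b`. -/
theorem θ_mul (g : G) (a b : 𝓑.ideal g⁻¹) : T.θ g (a * b) = T.θ g a * T.θ g b := by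
  refine Subtype.ext <| Subtype.ext ?_
  have ha : ((a : 𝓑.one) : B) ∈ 𝓑.D g⁻¹ := a.2
  have hb : ((b : 𝓑.one) : B) ∈ 𝓑.D g⁻¹ := b.2
  have hθa : ((T.θ g a : 𝓑.one) : B) ∈ 𝓑.D g := (T.θ g a).2
  have hθb : ((T.θ g b : 𝓑.one) : B) ∈ 𝓑.D g := (T.θ g b).2
  apply T.rho_injOn g (T.D_le_BD (T.θ g (a * b)).2) (T.D_le_BD (T.θ g a * T.θ g b).2)
  rw [T.rho_θ]
  change T.lam g (((a : 𝓑.one) : B) * ((b : 𝓑.one) : B)) =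
    T.rho g (((T.θ g a : 𝓑.one) : B) * ((T.θ g b : 𝓑.one) : B))
  rw [T.rho_mul _ (T.D_le_BD hθb), T.lam_mul _ (T.D_le_DB ha), T.rho_θ, ← T.rho_θ,
    T.rho_mul_eq_mul_lam (T.D_le_BD hθa) (T.D_le_DB hb)]

/-- The ideals `D g` and the isomorphisms `θ g`. -/
def partialActionData : PartialActionData k G 𝓑.one where
  D := 𝓑.ideal
  θ := T.θ
  θ_mul := T.θ_mul
  D_idem g := SetLike.ext fun a => by rw [T.mem_ideal_mul, and_self, mem_ideal]
  D_comm g h := SetLike.ext fun a => by rw [T.mem_ideal_mul, T.mem_ideal_mul, and_comm]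
  D_one a := (T.mem_D_iff_DB a.2).2 (T.comp_le_DB a.2)
  θ_one a := by
    refine Subtype.ext ?_
    have ha := a.2
    have hθ := (T.θ 1 a).2
    have h := T.rho_θ 1 a
    rw [T.rho_one (T.D_le_BD hθ), T.lam_one] at h
    · exact h
    · exact T.D_le_DB (T.D_le_D_one ha)
  θ_image g h := by
    ext x
    constructor
    · rintro ⟨a, ha, rfl⟩
      exact T.mem_ideal_mul.2 ⟨(T.θ g a).2, (T.θ_mem_D_iff a).2 (T.mem_ideal_mul.1 ha).2⟩
    · intro hx
      obtain ⟨hg, hgh⟩ := T.mem_ideal_mul.1 hx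
      obtain ⟨a, ha⟩ := (T.θ g).surjective ⟨x, hg⟩
      have hax : (T.θ g a : 𝓑.one) = x := congrArg Subtype.val ha
      refine ⟨a, T.mem_ideal_mul.2 ⟨a.2, (T.θ_mem_D_iff a).1 ?_⟩, hax⟩
      rw [hax]
      exact hgh

theorem twistR_one_left {g : G} {x : B} (hx : x ∈ 𝓑.D 1) (hg : x ∈ 𝓑.D (1 * g)) :
    T.twistR 1 g x = x := by
  rw [twistR, T.rho_one (T.D_le_BD hx)]
  rw [one_mul] at hg ⊢
  exact T.rhoInv_rho (T.D_le_BD hg)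

theorem twistL_one_left {g : G} {x : B} (hx : x ∈ 𝓑.D 1) (hg : x ∈ 𝓑.D (1 * g)) :
    T.twistL 1 g x = x := by
  rw [one_mul] at hg
  rw [twistL, one_mul, T.lam_lamInv (T.D_le_DB hg), T.lam_one (T.D_le_DB hx)]

theorem twistR_one_right {g : G} {x : B} (hx : x ∈ 𝓑.D g) (hg : x ∈ 𝓑.D (g * 1)) :
    T.twistR g 1 x = x := by
  rw [twistR, T.rho_one (T.rho_mem_BD_of_mem hx hg), mul_one, T.rhoInv_rho (T.D_le_BD hx)]

theorem twistL_one_right {g : G} {x : B} (hx : x ∈ 𝓑.D g) (hg : x ∈ 𝓑.D (g * 1)) :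
    T.twistL g 1 x = x := by
  have h := T.lamInv_mem_DB_of_mem hx hg
  rw [inv_one] at h
  rw [twistL, T.lam_one h, mul_one, T.lam_lamInv (T.D_le_DB hx)]

theorem w_one_left (g : G) : T.w 1 g = 1 :=
  Units.ext <| Multiplier.ext
    (LinearMap.ext fun x => Subtype.ext <| Subtype.ext <|
      T.twistR_one_left (T.coe_mem_left x) (T.coe_mem_right x))
    (LinearMap.ext fun x => Subtype.ext <| Subtype.ext <|
      T.twistL_one_left (T.coe_mem_left x) (T.coe_mem_right x))

theorem w_one_right (g : G) : T.w g 1 = 1 :=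
  Units.ext <| Multiplier.ext
    (LinearMap.ext fun x => Subtype.ext <| Subtype.ext <|
      T.twistR_one_right (T.coe_mem_left x) (T.coe_mem_right x))
    (LinearMap.ext fun x => Subtype.ext <| Subtype.ext <|
      T.twistL_one_right (T.coe_mem_left x) (T.coe_mem_right x))

end LocalUnits
end GroupGrading

/-! ### The twisted partial action and the isomorphism `a δ_g ↦ a u_g`. -/

namespace GroupGrading

variable {k G B : Type*} [CommRing k] [Group G] [DecidableEq G] [NonUnitalRing B]
  [Module k B] [IsScalarTower k B B] [SMulCommClass k B B] {𝓑 : GroupGrading k G B}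

namespace LocalUnits

variable (T : 𝓑.LocalUnits)

/-- Here `x = θ_h(a)`, `y = θ_g(x)` and `z = θ_{gh}(a)`. After right multiplication by `u_{gh}` both
sides become `u_g u_h a`: on the left because `u_{gh}⁻¹ z u_{gh} = a`, on the right because `y u_g
u_h = u_g x u_h`. -/
theorem twistL_eq_twistR_of_rho_eq {g h : G} {a x y z : B} (ha : a ∈ 𝓑.D (g * h)⁻¹)
    (hxg : x ∈ 𝓑.D g⁻¹) (hxh : x ∈ 𝓑.D h) (hyg : y ∈ 𝓑.D g) (hygh : y ∈ 𝓑.D (g * h))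
    (hzg : z ∈ 𝓑.D g) (hzgh : z ∈ 𝓑.D (g * h)) (hx : T.rho h x = T.lam h a)
    (hy : T.rho g y = T.lam g x) (hz : T.rho (g * h) z = T.lam (g * h) a) :
    T.twistL g h z = T.twistR g h y := by
  apply T.rho_injOn (g * h) (T.D_le_BD (T.twistL_mem_D hzg hzgh hzgh))
    (T.D_le_BD (T.twistR_mem_D hyg hygh hygh))
  have hc := T.lamInv_mem_BD (T.D_le_DB hzgh) (T.D_le_BD hzgh)
  have hc' := T.lamInv_mem_DB_of_mem hzg hzgh
  have hc'' := T.lamInv_mem_DB (T.D_le_DB hzgh)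
  have hca : T.rho (g * h) (T.lamInv (g * h) z) = a := by
    apply T.lam_injOn (g * h) (T.rho_mem_DB hc hc'') (T.D_le_DB ha)
    rw [T.lam_rho hc'' hc, T.lam_lamInv (T.D_le_DB hzgh), hz]
  rw [T.rho_twistR hyg hygh, hy, ← T.lam_rho (T.D_le_DB hxg) (T.D_le_BD hxh), hx, twistL,
    ← T.lam_rho (T.comp_le_DB (T.lam_lamInv_mem_comp hzg hzgh)) (T.lam_mem_BD hc' hc),
    ← T.lam_rho hc' hc, hca]

/-- With `x = θ_g(a)` and `y = θ_g(a w_{h,t})`, both sides are `u_g a u_h u_t u_{ght}⁻¹`. -/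
theorem twistR_cocycle {g h t : G} {a x y : B} (hag : a ∈ 𝓑.D g⁻¹) (hah : a ∈ 𝓑.D h)
    (hat : a ∈ 𝓑.D (h * t)) (hxg : x ∈ 𝓑.D g) (hxgh : x ∈ 𝓑.D (g * h))
    (hx : T.rho g x = T.lam g a) (hy : T.rho g y = T.lam g (T.twistR h t a)) :
    T.twistR g (h * t) y = T.twistR (g * h) t (T.twistR g h x) := by
  have h1 := T.rho_mem_BD_of_mem hah hat
  rw [twistR, hy, ← T.lam_rho (T.D_le_DB (T.twistR_mem_D hah hat hag))
      (T.D_le_BD (T.twistR_mem_D hah hat hat)), T.rho_twistR hah hat,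
    T.lam_rho (T.rho_mem_DB (T.D_le_BD hah) (T.D_le_DB hag)) h1,
    T.lam_rho (T.D_le_DB hag) (T.D_le_BD hah), twistR, T.rho_twistR hxg hxgh, hx, mul_assoc]

/-- The twisted partial action given by the formal units `u_g`. -/
noncomputable def twistedPartialAction : TwistedPartialAction k G 𝓑.one where
  toPartialActionData := T.partialActionData
  w := T.w
  θ_θ g h a ha := by
    obtain ⟨hah, hagh⟩ := T.mem_ideal_mul.1 ha
    have hagh' : (a : B) ∈ 𝓑.D (g * h)⁻¹ := by rw [mul_inv_rev]; exact hagh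
    refine congrArg Subtype.val
      (Multiplier.inv_R_eq_of_eq_R (T.w g h) (a := T.mkMul _ (T.θ g _).2 ?_) ?_).symm
    · exact (T.θ_mem_D_iff _).2 (T.θ h _).2
    · refine Subtype.ext <| Subtype.ext ?_
      exact T.twistL_eq_twistR_of_rho_eq hagh'
        (T.partialActionData.θ_mem_inv ha) (T.θ h _).2 (T.θ g _).2
        ((T.θ_mem_D_iff _).2 (T.θ h _).2) (T.coe_mem_left _) (T.coe_mem_right _)
        (T.rho_θ h _) (T.rho_θ g _) (T.rho_θ (g * h) _)
  w_one_left := T.w_one_left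
  w_one_right := T.w_one_right
  cocycle g h t a ha := by
    have hag : (a : B) ∈ 𝓑.D g⁻¹ := T.partialActionData.mem_inv ha
    obtain ⟨hah, hat⟩ := T.mem_ideal_mul.1 (T.partialActionData.mem_mul_two ha)
    refine Subtype.ext ?_
    exact T.twistR_cocycle hag hah hat (T.θ g _).2 ((T.θ_mem_D_iff _).2 hah)
      (T.rho_θ g _) (T.rho_θ g _)

-- With `c = θ_g⁻¹(a)`, one has `θ_g(c b) w_{g,h} u_{gh} = θ_g(c b) u_g u_h = u_g c b u_h = (a
-- u_g)(b u_h)`.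
open TwistedPartialAction in
theorem coe_homogMul (g h : G) (a : 𝓑.ideal g) (b : 𝓑.ideal h) :
    T.rho (g * h) ((T.twistedPartialAction.homogMul g h a b : 𝓑.one) : B) =
      T.rho g ((a : 𝓑.one) : B) * T.rho h ((b : 𝓑.one) : B) := by
  set p := T.twistedPartialAction.preMul g h a b with hp
  set c := (T.θ g).symm a with hc
  have h1 : T.rho g ((p : 𝓑.one) : B) = T.lam g (((c : 𝓑.one) : B) * ((b : 𝓑.one) : B)) :=
    T.rho_θ g _
  have h2 : T.rho g ((a : 𝓑.one) : B) = T.lam g ((c : 𝓑.one) : B) := by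
    rw [← T.rho_θ, hc, LinearEquiv.apply_symm_apply]
  have h3 : T.rho (g * h) ((T.twistedPartialAction.homogMul g h a b : 𝓑.one) : B) =
      T.rho h (T.rho g ((p : 𝓑.one) : B)) :=
    T.rho_twistR (T.coe_mem_left p) (T.coe_mem_right p)
  rw [h3, h1, h2, T.lam_mul _ (T.D_le_DB c.2), T.rho_mul _ (T.D_le_BD b.2)]

/-- The map `a δ_g ↦ a u_g` from the crossed product to `B`. -/
noncomputable def crossedProductEquiv : T.twistedPartialAction.CrossedProduct ≃ₗ[k] B :=
  (DFinsupp.mapRange.linearEquiv fun g => (𝓑.idealEquiv g).trans (T.ψ g)).trans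
    (LinearEquiv.ofBijective (DirectSum.coeLinearMap 𝓑.comp) 𝓑.isInternal)

open TwistedPartialAction in
theorem crossedProductEquiv_single (g : G) (a : 𝓑.ideal g) :
    T.crossedProductEquiv (CrossedProduct.single T.twistedPartialAction g a) =
      T.ψ g (𝓑.idealEquiv g a) := by
  have h : DFinsupp.mapRange.linearEquiv (fun g => (𝓑.idealEquiv g).trans (T.ψ g))
      (DFinsupp.single g a) = DirectSum.lof k G (fun g => 𝓑.comp g) g
        (T.ψ g (𝓑.idealEquiv g a)) := by
    rw [DFinsupp.mapRange.linearEquiv_apply, DFinsupp.mapRange_single]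
    rfl
  change DirectSum.coeLinearMap 𝓑.comp (DFinsupp.mapRange.linearEquiv
    (fun g => (𝓑.idealEquiv g).trans (T.ψ g)) (DFinsupp.single g a)) = _
  rw [h, DirectSum.coeLinearMap_lof]

open TwistedPartialAction in
theorem crossedProductEquiv_mul (x y : T.twistedPartialAction.CrossedProduct) :
    T.crossedProductEquiv (x * y) = T.crossedProductEquiv x * T.crossedProductEquiv y := by
  have h : (CrossedProduct.mulHom T.twistedPartialAction).compr₂ T.crossedProductEquiv.toLinearMap =
      (LinearMap.mul k B).compl₁₂ T.crossedProductEquiv.toLinearMap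
        T.crossedProductEquiv.toLinearMap := by
    refine DirectSum.linearMap_ext k fun g => LinearMap.ext fun a =>
      DirectSum.linearMap_ext k fun h => LinearMap.ext fun b => ?_
    change T.crossedProductEquiv (CrossedProduct.single T.twistedPartialAction g a *
      CrossedProduct.single T.twistedPartialAction h b) =
      T.crossedProductEquiv (CrossedProduct.single T.twistedPartialAction g a) *
      T.crossedProductEquiv (CrossedProduct.single T.twistedPartialAction h b)
    rw [CrossedProduct.single_mul_single]
    have key : ∀ (p : G) (c : 𝓑.ideal p), T.crossedProductEquiv
        (CrossedProduct.single T.twistedPartialAction p c) = T.rho p ((c : 𝓑.one) : B) :=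
      fun p c => (T.crossedProductEquiv_single p c).trans (T.rho_coe (𝓑.idealEquiv p c)).symm
    exact (key _ _).trans ((T.coe_homogMul g h a b).trans (by rw [key g a, key h b]))
  exact LinearMap.congr_fun₂ h x y

include T in
theorem isCrossedProduct : 𝓑.IsCrossedProduct := by
  refine ⟨T.twistedPartialAction, T.crossedProductEquiv.symm, fun x y => ?_, fun g => ?_⟩
  · apply T.crossedProductEquiv.injective
    simp [crossedProductEquiv_mul]
  · ext x
    constructor
    · rintro ⟨b, hb, rfl⟩
      refine ⟨(𝓑.idealEquiv g).symm ((T.ψ g).symm ⟨b, hb⟩), T.crossedProductEquiv.injective ?_⟩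
      refine (T.crossedProductEquiv_single g _).trans ?_
      simp
    · rintro ⟨a, rfl⟩
      refine ⟨T.ψ g (𝓑.idealEquiv g a), (T.ψ g _).2, ?_⟩
      rw [← T.crossedProductEquiv_single g a]
      simp

end LocalUnits

/-- Balanced families of isomorphisms can be normalized at `1`. -/
theorem exists_localUnits (hD : ∀ g : G, IsSUnital (𝓑.D g))
    (hreg : ∀ g : G, mulSpan (mulSpan (𝓑.comp g) (𝓑.comp g⁻¹)) (𝓑.comp g) = 𝓑.comp g)
    (hψ : ∀ g : G, ∃ (ψ : 𝓑.D g ≃ₗ[k] 𝓑.comp g) (ψ' : 𝓑.D g⁻¹ ≃ₗ[k] 𝓑.comp g),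
        (∀ d x : 𝓑.D g, (ψ (d * x) : B) = d * ψ x) ∧
        (∀ x d : 𝓑.D g⁻¹, (ψ' (x * d) : B) = ψ' x * d) ∧
        ∀ (d : 𝓑.D g) (d' : 𝓑.D g⁻¹), (ψ d : B) * d' = d * ψ' d') :
    Nonempty 𝓑.LocalUnits := by
  -- Condition (i) at `1` gives `D_1 = B_1`, so identity maps can replace the given isomorphisms
  -- there; this makes `w_{1,g} = w_{g,1} = 1`. The variable `g` also covers the index `1⁻¹`.
  have hone : ∀ g : G, g = 1 → (𝓑.D g).toSubmodule = 𝓑.comp 1 := by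
    rintro g rfl
    apply le_antisymm (𝓑.mulSpan_inv_le_one 1)
    have h := hreg 1
    rw [mulSpan_assoc] at h
    conv_lhs => rw [← h]
    refine mulSpan_mono le_rfl (mulSpan_le.2 fun a ha b hb => ?_)
    exact LocalUnits.mul_mem_of_eq ha hb (by group)
  have hψ' : ∀ g : G, ∃ (ψ : 𝓑.D g ≃ₗ[k] 𝓑.comp g) (ψ' : 𝓑.D g⁻¹ ≃ₗ[k] 𝓑.comp g),
      (∀ d x : 𝓑.D g, (ψ (d * x) : B) = d * ψ x) ∧
      (∀ x d : 𝓑.D g⁻¹, (ψ' (x * d) : B) = ψ' x * d) ∧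
      (∀ (d : 𝓑.D g) (d' : 𝓑.D g⁻¹), (ψ d : B) * d' = d * ψ' d') ∧
      (g = 1 → (∀ d : 𝓑.D g, (ψ d : B) = d) ∧ ∀ d : 𝓑.D g⁻¹, (ψ' d : B) = d) := by
    intro g
    by_cases hg : g = 1
    · subst hg
      exact ⟨LinearEquiv.ofEq _ _ (hone 1 rfl), LinearEquiv.ofEq _ _ (hone 1⁻¹ inv_one),
        fun _ _ => rfl, fun _ _ => rfl, fun _ _ => rfl, fun _ => ⟨fun _ => rfl, fun _ => rfl⟩⟩
    · obtain ⟨ψ, ψ', h1, h2, h3⟩ := hψ g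
      exact ⟨ψ, ψ', h1, h2, h3, fun h => absurd h hg⟩
  choose ψ ψ' h1 h2 h3 h4 using hψ'
  exact ⟨⟨hD, hreg, ψ, ψ', h1, h2, h3, (h4 1 rfl).1, (h4 1 rfl).2⟩⟩

end GroupGrading

/-! ### Converse: the two conditions hold in a crossed product. -/

/-- The inclusion of an ideal. -/
def AlgIdeal.subtype {k A : Type*} [CommRing k] [NonUnitalRing A] [Module k A]
    (I : AlgIdeal k A) : I →ₗ[k] A where
  toFun := Subtype.val
  map_add' _ _ := rfl
  map_smul' _ _ := rfl

namespace TwistedPartialAction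

variable {k G A : Type*} [CommRing k] [Group G] [NonUnitalRing A] [Module k A]
  [IsScalarTower k A A] [SMulCommClass k A A] (Θ : TwistedPartialAction k G A)

theorem coe_homogMul_one_left (g : G) (a : Θ.D 1) (b : Θ.D g) :
    (Θ.homogMul 1 g a b : A) = a * b := by
  have h1 : (Θ.homogMul 1 g a b : A) = Θ.preMul 1 g a b := by
    change (((Θ.w 1 g).val.R (Θ.preMul 1 g a b) : ↥(Θ.D 1 * Θ.D (1 * g))) : A) = _
    rw [Θ.w_one_left]
    rfl
  have h2 : (((Θ.θ 1).symm a : Θ.D (1 : G)⁻¹) : A) = a := by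
    rw [← Θ.θ_one, LinearEquiv.apply_symm_apply]
  rw [h1]
  change (Θ.θ 1 _ : A) = _
  rw [Θ.θ_one]
  exact congrArg (· * (b : A)) h2

theorem coe_homogMul_one_right (g : G) (a : Θ.D g) (b : Θ.D 1) :
    (Θ.homogMul g 1 a b : A) =
      Θ.θ g ⟨((Θ.θ g).symm a : A) * b, AlgIdeal.mul_mem_right _ _ ((Θ.θ g).symm a).2⟩ := by
  change (((Θ.w g 1).val.R (Θ.preMul g 1 a b) : ↥(Θ.D g * Θ.D (g * 1))) : A) = _
  rw [Θ.w_one_right]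
  rfl

theorem mem_mulSpan_self {g : G} {a : A} (ha : a ∈ Θ.D g) :
    a ∈ mulSpan (Θ.D g).toSubmodule (Θ.D g).toSubmodule := by
  rw [← Θ.D_idem g] at ha
  exact ha

/-- By idempotence `D_g = D_g D_g ⊆ D_g D_1`. Thus `w_{g,g⁻¹}` acts on all of `D_g`. -/
theorem mem_mul_mul_inv {g : G} {a : A} (ha : a ∈ Θ.D g) : a ∈ Θ.D g * Θ.D (g * g⁻¹) := by
  refine mulSpan_mono le_rfl (fun x _ => ?_) (Θ.mem_mulSpan_self ha)
  rw [mul_inv_cancel]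
  exact Θ.D_one x

theorem w_R_surjective (g h : G) : Function.Surjective (Θ.w g h).val.R := fun x =>
  ⟨(Θ.w g h)⁻¹.val.R x, congrArg (fun v : Multiplier k _ => v.R x) (Θ.w g h).inv_mul⟩

/-- `θ g` as a map into `D g * D (g * g⁻¹)`. -/
def θMul (g : G) : Θ.D g⁻¹ →ₗ[k] ↥(Θ.D g * Θ.D (g * g⁻¹)) where
  toFun a := ⟨Θ.θ g a, Θ.mem_mul_mul_inv (Θ.θ g a).2⟩
  map_add' a b := Subtype.ext (by simp)
  map_smul' c a := Subtype.ext (by simp)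

end TwistedPartialAction

namespace GroupGrading

variable {k G B : Type*} [CommRing k] [Group G] [DecidableEq G] [NonUnitalRing B]
  [Module k B] [IsScalarTower k B B] [SMulCommClass k B B]

/-- Linear isomorphisms of the homogeneous components of a crossed product with those of `B` that
are compatible with the multiplication. -/
structure CrossedProductModel (𝓑 : GroupGrading k G B)
    (Θ : TwistedPartialAction k G 𝓑.one) where
  σ : ∀ g : G, Θ.D g ≃ₗ[k] 𝓑.comp g
  σ_mul : ∀ (g h : G) (a : Θ.D g) (b : Θ.D h), (σ g a : B) * σ h b = σ (g * h) (Θ.homogMul g h a b)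

variable {𝓑 : GroupGrading k G B}

open TwistedPartialAction in
theorem IsCrossedProduct.exists_model (h : 𝓑.IsCrossedProduct) :
    ∃ Θ : TwistedPartialAction k G 𝓑.one, Nonempty (𝓑.CrossedProductModel Θ) := by
  obtain ⟨Θ, φ, hφ, hr⟩ := h
  have hinj : ∀ g, Function.Injective
      (φ.symm.toLinearMap ∘ₗ CrossedProduct.single Θ g) := fun g =>
    φ.symm.injective.comp (DFinsupp.single_injective (β := fun g => Θ.D g) (i := g))
  have hrange : ∀ g, LinearMap.range (φ.symm.toLinearMap ∘ₗ CrossedProduct.single Θ g) =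
      𝓑.comp g := by
    intro g
    rw [LinearMap.range_comp, ← hr g, ← Submodule.map_comp]
    convert Submodule.map_id (𝓑.comp g)
    ext x
    simp
  refine ⟨Θ, ⟨fun g => (LinearEquiv.ofInjective _ (hinj g)).trans
    (LinearEquiv.ofEq _ _ (hrange g)), fun g h a b => ?_⟩⟩
  change φ.symm (CrossedProduct.single Θ g a) * φ.symm (CrossedProduct.single Θ h b) =
    φ.symm (CrossedProduct.single Θ (g * h) (Θ.homogMul g h a b))
  apply φ.injective
  rw [hφ, φ.apply_symm_apply, φ.apply_symm_apply, φ.apply_symm_apply,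
    CrossedProduct.single_mul_single]

namespace CrossedProductModel

variable {Θ : TwistedPartialAction k G 𝓑.one} (M : 𝓑.CrossedProductModel Θ)

theorem σ_congr {g h : G} (hgh : g = h) {a : Θ.D g} {b : Θ.D h} (hab : (a : 𝓑.one) = b) :
    (M.σ g a : B) = M.σ h b := by
  subst hgh
  rw [Subtype.ext hab]

/-- The map `a ↦ a δ_1`. -/
def τ : 𝓑.one →ₗ[k] B where
  toFun a := M.σ 1 ⟨a, Θ.D_one a⟩
  map_add' a b := congrArg Subtype.val (map_add (M.σ 1) ⟨a, Θ.D_one a⟩ ⟨b, Θ.D_one b⟩)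
  map_smul' c a := congrArg Subtype.val (map_smul (M.σ 1) c ⟨a, Θ.D_one a⟩)

theorem τ_injective : Function.Injective M.τ := fun _ _ h =>
  congrArg Subtype.val ((M.σ 1).injective (Subtype.ext h))

theorem τ_mul_σ (g : G) (a : 𝓑.one) (b : Θ.D g) :
    M.τ a * M.σ g b = M.σ g ⟨a * b, AlgIdeal.mul_mem_left _ a b.2⟩ :=
  (M.σ_mul 1 g ⟨a, Θ.D_one a⟩ b).trans
    (M.σ_congr (one_mul g) (Θ.coe_homogMul_one_left g ⟨a, Θ.D_one a⟩ b))

theorem τ_mul (a b : 𝓑.one) : M.τ (a * b) = M.τ a * M.τ b :=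
  (M.τ_mul_σ 1 a ⟨b, Θ.D_one b⟩).symm

theorem σ_mul_τ (g : G) (a : Θ.D g) (b : 𝓑.one) :
    M.σ g a * M.τ b = M.σ g (Θ.θ g
      ⟨((Θ.θ g).symm a : 𝓑.one) * b, AlgIdeal.mul_mem_right _ _ ((Θ.θ g).symm a).2⟩) :=
  (M.σ_mul g 1 a ⟨b, Θ.D_one b⟩).trans
    (M.σ_congr (mul_one g) (Θ.coe_homogMul_one_right g a ⟨b, Θ.D_one b⟩))

theorem σ_mul_σ_inv (g : G) (a : Θ.D g) (b : Θ.D g⁻¹) :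
    (M.σ g a : B) * M.σ g⁻¹ b = M.τ (Θ.homogMul g g⁻¹ a b) :=
  (M.σ_mul g g⁻¹ a b).trans (M.σ_congr (mul_inv_cancel g) rfl)

/-- Rests on `(θ_g(x) δ_g)(y δ_{g⁻¹}) = θ_g(x y) w_{g,g⁻¹} δ_1`: the products `x y` span `D_{g⁻¹}`,
which `θ_g` followed by `w_{g,g⁻¹}` maps onto `D_g`. -/
theorem map_τ (g : G) : (Θ.D g).toSubmodule.map M.τ = mulSpan (𝓑.comp g) (𝓑.comp g⁻¹) := by
  apply le_antisymm
  · rintro _ ⟨e, he, rfl⟩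
    obtain ⟨f, hf⟩ := Θ.w_R_surjective g g⁻¹ ⟨e, Θ.mem_mul_mul_inv he⟩
    obtain ⟨c, hc⟩ := (Θ.θ g).surjective ⟨f, AlgIdeal.mem_left_of_mem_mul f.2⟩
    -- `F` sends `c` to `θ_g(c) w_{g,g⁻¹} δ_1`, and `c` was chosen so that this is `e δ_1`. By
    -- linearity it suffices to treat products `c = x y`.
    let F : Θ.D g⁻¹ →ₗ[k] B := M.τ ∘ₗ AlgIdeal.subtype _ ∘ₗ (Θ.w g g⁻¹).val.R ∘ₗ Θ.θMul g
    have hF : F c = M.τ e := by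
      have h : Θ.θMul g c = f := by
        refine Subtype.ext ?_
        change (Θ.θ g c : 𝓑.one) = f
        rw [hc]
      change M.τ ((Θ.w g g⁻¹).val.R (Θ.θMul g c) : ↥(Θ.D g * Θ.D (g * g⁻¹))) = _
      rw [h, hf]
    have hc' : (c : 𝓑.one) ∈ mulSpan (Θ.D g⁻¹).toSubmodule (Θ.D g⁻¹).toSubmodule :=
      Θ.mem_mulSpan_self c.2
    have hle : mulSpan (Θ.D g⁻¹).toSubmodule (Θ.D g⁻¹).toSubmodule ≤
        ((mulSpan (𝓑.comp g) (𝓑.comp g⁻¹)).comap F).map (AlgIdeal.subtype _) := by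
      refine mulSpan_le.2 fun x hx y hy => ⟨⟨x, hx⟩ * ⟨y, hy⟩, ?_, rfl⟩
      have hxy : F (⟨x, hx⟩ * ⟨y, hy⟩) = M.σ g (Θ.θ g ⟨x, hx⟩) * M.σ g⁻¹ ⟨y, hy⟩ := by
        rw [M.σ_mul_σ_inv]
        change M.τ ((Θ.w g g⁻¹).val.R (Θ.θMul g (⟨x, hx⟩ * ⟨y, hy⟩)) :
          ↥(Θ.D g * Θ.D (g * g⁻¹))) = M.τ ((Θ.w g g⁻¹).val.R
            (Θ.preMul g g⁻¹ (Θ.θ g ⟨x, hx⟩) ⟨y, hy⟩) : ↥(Θ.D g * Θ.D (g * g⁻¹)))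
        congr 3
        refine Subtype.ext ?_
        change (Θ.θ g (⟨x, hx⟩ * ⟨y, hy⟩) : 𝓑.one) = Θ.θ g ⟨_, _⟩
        congr 2
        refine Subtype.ext ?_
        simp
      rw [SetLike.mem_coe, Submodule.mem_comap, hxy]
      exact mul_mem_mulSpan (M.σ g _).2 (M.σ g⁻¹ _).2
    obtain ⟨c', h1, h2⟩ := hle hc'
    have hcc : c' = c := Subtype.ext h2
    rw [← hF, ← hcc]
    exact h1
  · refine mulSpan_le.2 fun x hx y hy => ?_
    obtain ⟨a, ha⟩ := (M.σ g).surjective ⟨x, hx⟩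
    obtain ⟨b, hb⟩ := (M.σ g⁻¹).surjective ⟨y, hy⟩
    refine ⟨Θ.homogMul g g⁻¹ a b, ?_, ?_⟩
    · exact AlgIdeal.mem_left_of_mem_mul
        ((Θ.w g g⁻¹).val.R (Θ.preMul g g⁻¹ a b)).2
    · rw [← M.σ_mul_σ_inv, ha, hb]

-- For the nontrivial inclusion, `D_g` is spanned by products `y z`, and `(y z) δ_g = (y δ_1)(z
-- δ_g)` with `y δ_1 ∈ B_g B_{g⁻¹}` by `map_τ`.
include M in
theorem regular (g : G) :
    mulSpan (mulSpan (𝓑.comp g) (𝓑.comp g⁻¹)) (𝓑.comp g) = 𝓑.comp g := by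
  apply le_antisymm
  · exact mulSpan_le.2 fun x hx y hy =>
      LocalUnits.mul_mem_of_eq (𝓑.mulSpan_inv_le_one g hx) hy (one_mul g)
  · intro x hx
    obtain ⟨a, ha⟩ := (M.σ g).surjective ⟨x, hx⟩
    have hle : mulSpan (Θ.D g).toSubmodule (Θ.D g).toSubmodule ≤
        ((mulSpan (mulSpan (𝓑.comp g) (𝓑.comp g⁻¹)) (𝓑.comp g)).comap
          ((𝓑.comp g).subtype ∘ₗ (M.σ g).toLinearMap)).map (AlgIdeal.subtype _) := by
      refine mulSpan_le.2 fun y hy z hz => ⟨⟨y, hy⟩ * ⟨z, hz⟩, ?_, rfl⟩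
      change (M.σ g (⟨y, hy⟩ * ⟨z, hz⟩) : B) ∈
        mulSpan (mulSpan (𝓑.comp g) (𝓑.comp g⁻¹)) (𝓑.comp g)
      have h : (M.σ g (⟨y, hy⟩ * ⟨z, hz⟩) : B) = M.τ y * M.σ g ⟨z, hz⟩ :=
        (M.τ_mul_σ g y ⟨z, hz⟩).symm
      rw [h, ← M.map_τ g]
      exact mul_mem_mulSpan ⟨y, hy, rfl⟩ (M.σ g _).2
    have ha' : (a : 𝓑.one) ∈ mulSpan (Θ.D g).toSubmodule (Θ.D g).toSubmodule :=
      Θ.mem_mulSpan_self a.2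
    obtain ⟨a', h1, h2⟩ := hle ha'
    have haa : a' = a := Subtype.ext h2
    have hxa : x = M.σ g a' := by rw [haa, ha]
    rw [hxa]
    exact h1

/-- The isomorphism `a ↦ a δ_1` from `D g` onto `B_g B_{g⁻¹}`. -/
noncomputable def δ (g : G) : Θ.D g ≃ₗ[k] 𝓑.D g :=
  LinearEquiv.ofBijective
    { toFun := fun a : Θ.D g => ⟨M.τ a, (M.map_τ g).le ⟨(a : 𝓑.one), a.2, rfl⟩⟩
      map_add' := fun a b => Subtype.ext (map_add M.τ (a : 𝓑.one) b)
      map_smul' := fun c a => Subtype.ext (map_smul M.τ c (a : 𝓑.one)) }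
    ⟨fun x y h => by
      have h1 : M.τ x = M.τ y := congrArg (fun d : 𝓑.D g => (d : B)) h
      exact Subtype.ext (M.τ_injective h1), fun d => by
      obtain ⟨a, ha, had⟩ := (M.map_τ g).ge d.2
      exact ⟨⟨a, ha⟩, Subtype.ext had⟩⟩

theorem coe_δ (g : G) (a : Θ.D g) : (M.δ g a : B) = M.τ a := rfl

theorem δ_mul (g : G) (a b : Θ.D g) : M.δ g (a * b) = M.δ g a * M.δ g b :=
  Subtype.ext (M.τ_mul a b)

-- Take `ψ_g(a δ_1) = a δ_g` and `ψ'_g(b δ_1) = θ_g(b) δ_g`. Balance is multiplicativity of `θ_g`: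
-- `(a δ_g)(b δ_1) = θ_g(θ_g⁻¹(a) b) δ_g = a θ_g(b) δ_g`.
include M in
theorem exists_balanced (g : G) :
    ∃ (ψ : 𝓑.D g ≃ₗ[k] 𝓑.comp g) (ψ' : 𝓑.D g⁻¹ ≃ₗ[k] 𝓑.comp g),
      (∀ d x : 𝓑.D g, (ψ (d * x) : B) = d * ψ x) ∧
      (∀ x d : 𝓑.D g⁻¹, (ψ' (x * d) : B) = ψ' x * d) ∧
      ∀ (d : 𝓑.D g) (d' : 𝓑.D g⁻¹), (ψ d : B) * d' = d * ψ' d' := by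
  refine ⟨(M.δ g).symm.trans (M.σ g), (M.δ g⁻¹).symm.trans ((Θ.θ g).trans (M.σ g)), ?_, ?_, ?_⟩
  · intro d x
    obtain ⟨a, rfl⟩ := (M.δ g).surjective d
    obtain ⟨b, rfl⟩ := (M.δ g).surjective x
    rw [← δ_mul]
    simp only [LinearEquiv.trans_apply, LinearEquiv.symm_apply_apply, coe_δ, τ_mul_σ]
    rfl
  · intro x d
    obtain ⟨a, rfl⟩ := (M.δ g⁻¹).surjective x
    obtain ⟨b, rfl⟩ := (M.δ g⁻¹).surjective d
    rw [← δ_mul]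
    simp only [LinearEquiv.trans_apply, LinearEquiv.symm_apply_apply, coe_δ, σ_mul_τ]
    rfl
  · intro d d'
    obtain ⟨a, rfl⟩ := (M.δ g).surjective d
    obtain ⟨b, rfl⟩ := (M.δ g⁻¹).surjective d'
    simp only [LinearEquiv.trans_apply, LinearEquiv.symm_apply_apply, coe_δ, σ_mul_τ, τ_mul_σ]
    have h := Θ.θ_mul g ((Θ.θ g).symm a) b
    rw [LinearEquiv.apply_symm_apply] at h
    exact congrArg (fun z => (M.σ g z : B)) h

end CrossedProductModel

end GroupGrading

theorem theorem5p2 {k G B : Type*} [CommRing k] [Group G] [DecidableEq G] [NonUnitalRing B]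
    [Module k B] [IsScalarTower k B B] [SMulCommClass k B B] (𝓑 : GroupGrading k G B)
    (hD : ∀ g : G, IsSUnital (𝓑.D g)) :
    𝓑.IsCrossedProduct ↔
      (∀ g : G, mulSpan (mulSpan (𝓑.comp g) (𝓑.comp g⁻¹)) (𝓑.comp g) = 𝓑.comp g) ∧
      ∀ g : G, ∃ (ψ : 𝓑.D g ≃ₗ[k] 𝓑.comp g) (ψ' : 𝓑.D g⁻¹ ≃ₗ[k] 𝓑.comp g),
        (∀ d x : 𝓑.D g, (ψ (d * x) : B) = d * ψ x) ∧
        (∀ x d : 𝓑.D g⁻¹, (ψ' (x * d) : B) = ψ' x * d) ∧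
        ∀ (d : 𝓑.D g) (d' : 𝓑.D g⁻¹), (ψ d : B) * d' = d * ψ' d' := by
  constructor
  · intro h
    obtain ⟨Θ, ⟨M⟩⟩ := h.exists_model
    exact ⟨M.regular, M.exists_balanced⟩
  · rintro ⟨hreg, hψ⟩
    obtain ⟨T⟩ := GroupGrading.exists_localUnits hD hreg hψ
    exact T.isCrossedProduct
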